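/- Let $q>0$, $q\neq 1$ be real, $\lambda=q-q^{-1}$, $[n]=\frac{q^n-q^{-n}}{q-q^{-1}}$ and $(n)_{q^2}=\frac{q^{2n}-1}{q^2-1}$. Let $\mathcal X$ (quantum Minkowski space) be the complex algebra with generators $x_0,x_-,x_+,x_3$ and relations $$x_-x_0=x_0x_-,\quad x_+x_0=x_0x_+,\quad x_3x_0=x_0x_3,\quad q^{-1}x_-x_3-q\,x_3x_-=-\lambda x_-x_0,$$ $$q^{-1}x_3x_+-q\,x_+x_3=-\lambda x_+x_0,\quad x_-x_+-x_+x_--\lambda x_3x_3=-\lambda x_3x_0,$$ and let $x^2=x_0^2+q^{-1}x_-x_++q\,x_+x_--x_3^2$. Let $\hat{\mathcal X}=\mathcal X[\alpha]/(\alpha^2-[2]^2x_0^2+4x^2)$ be the extension by a central square root $\alpha$, let $\hat{\mathcal X}[\alpha^{-1}]$ be its localization at $\alpha$, and write $s=\sqrt{x_0^2-4x^2/[2]^2}:=\alpha/[2]$ and $$\xi_\pm=\tfrac12(x_0\pm s).$$ *$L$-matrices.* Let $\mathcal R=q^{H\otimes H/2}(1+\lambda E\otimes F)$ be the $R$-matrix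 of $\mathcal U_q(\mathrm{su}_2)$ in the square of the fundamental representation with weights $-,+$ (basis vectors $e_-,e_+$, $H e_\pm=\pm e_\pm$, $Ee_-=q^{1/2}e_+$, $Fe_+=q^{-1/2}e_-$, $Ee_+=Fe_-=0$), and let $R_{\mathrm{II}}=\mathcal R_{41}^{-1}\mathcal R_{13}\mathcal R_{24}\mathcal R_{23}$. Regard $R_{\mathrm{II}}$ as a matrix $R_{\mathrm{II}}^{\beta\mu}{}_{\alpha\nu}$ (rows $\beta\mu$, columns $\alpha\nu$) with four-vector indices in $\{0,-,+,3\}$, by means of the change of basis $x_{--}=[2]^{1/2}x_-$, $x_{-+}=q^{1/2}(x_3-x_0)$, $x_{+-}=q^{-1/2}x_3+q^{3/2}x_0$, $x_{++}=[2]^{1/2}x_+$. Put $(L_{x_\alpha})^\mu{}_\nu=\sum_\beta x_\beta R_{\mathrm{II}}^{\beta\mu}{}_{\alpha\nu}$ and, with $b=\frac{[2]}2x_0$, $c=x_0^2+\frac{\lambda^2}{[2]^2}x^2$ and $\sqrt{b^2-c}=\frac\lambda2 s$, define the $4\times4$-matrices with entries in $\hat{\mathcal X}[\alpha^{-1}]$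 $$\Pi_\pm=\tfrac12\Bigl(1\pm\frac{L_{x_0}-b}{\sqrt{b^2-c}}\Bigr).$$ *Calculus.* A calculus on $\hat{\mathcal X}$ is a pair $(M,\nabla)$ consisting of a unital $\mathbb C$-algebra homomorphism $M:\hat{\mathcal X}\to \mathrm{Mat}_4(\hat{\mathcal X}[\alpha^{-1}])$ (the action $f\mapsto\kappa L\triangleright f$) and a $\mathbb C$-linear map $\nabla:\hat{\mathcal X}\to\hat{\mathcal X}[\alpha^{-1}]^4$ (the $q$-Minkowski gradient, $(\nabla f)^\mu=\partial^\mu\triangleright f$) such that $$M(x_\alpha)=q\,L_{x_\alpha},\qquad M(s)=\tfrac q2\bigl([2]s+\lambda x_0\bigr)\Pi_++\tfrac q2\bigl([2]s-\lambda x_0\bigr)\Pi_-,$$ $$(\nabla x_\alpha)^\mu=\delta^\mu_\alpha,\qquad (\nabla(fg))^\mu=(\nabla f)^\mu\,g+\sum_\nu M(f)^\mu{}_\nu(\nabla g)^\nu .$$ **Proposition.** There is exactly one calculus $(M,\nabla)$ on $\hat{\mathcal X}$. It satisfies $$\nabla\xi_\pm=\Pi_\pm\nabla x_0 ,$$ and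 for every ordered polynomial $f(\xi_+,\xi_-)=\sum_{k,l}a_{kl}\,\xi_+^k\xi_-^l$ with complex coefficients $$\nabla f(\xi_+,\xi_-)=\frac{\partial_{q^2}f}{\partial_{q^2}\xi_+}\nabla\xi_++\frac{\partial_{q^2}f}{\partial_{q^2}\xi_-}\nabla\xi_-,$$ where $\frac{\partial_{q^2}f}{\partial_{q^2}\xi_+}=\sum a_{kl}(k)_{q^2}\xi_+^{k-1}\xi_-^l$ and $\frac{\partial_{q^2}f}{\partial_{q^2}\xi_-}=\sum a_{kl}(l)_{q^2}\xi_+^{k}\xi_-^{l-1}$ are the partial Jackson $q^2$-derivatives of the ordered polynomial. -/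

import Mathlib

open scoped BigOperators

namespace QMinkowski

noncomputable section

/-- The four-vector indices `0, -, +, 3`. -/
inductive Idx
  | zero | minus | plus | three
  deriving DecidableEq

instance : Fintype Idx where
  elems := {.zero, .minus, .plus, .three}
  complete := by intro μ; cases μ <;> simp

theorem Idx.sum_univ {M : Type*} [AddCommMonoid M] (f : Idx → M) :
    ∑ μ, f μ = f .zero + f .minus + f .plus + f .three := by
  have h : (Finset.univ : Finset Idx) = {.zero, .minus, .plus, .three} := rfl
  rw [h, Finset.sum_insert (by decide), Finset.sum_insert (by decide),
    Finset.sum_insert (by decide), Finset.sum_singleton]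
  simp only [add_assoc]

/-- The spinor indices `-` and `+` are `0` and `1` in `Fin 2`; pairs of them label the
spin-`(1/2,1/2)` representation. -/
abbrev Spin := Fin 2

/-- `λ = q - q⁻¹`. -/
def lam (q : ℝ) : ℝ := q - q⁻¹

/-- The symmetrized quantum number `[n] = (qⁿ - q⁻ⁿ) / (q - q⁻¹)`. -/
def qSym (q : ℝ) (n : ℕ) : ℝ := (q ^ n - q⁻¹ ^ n) / (q - q⁻¹)

/-- The standard quantum number `⟦n⟧ = (q²ⁿ - 1) / (q² - 1)`. -/
def qNum (q : ℝ) (n : ℕ) : ℝ := (q ^ (2 * n) - 1) / (q ^ 2 - 1)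

/-! ### Quantum Minkowski space and its extension by a central square root -/

section Algebras

open FreeAlgebra

/-- The defining relations of quantum Minkowski space. -/
inductive MinkRel (q : ℝ) : FreeAlgebra ℂ Idx → FreeAlgebra ℂ Idx → Prop
  | minus_zero : MinkRel q (ι ℂ .minus * ι ℂ .zero) (ι ℂ .zero * ι ℂ .minus)
  | plus_zero : MinkRel q (ι ℂ .plus * ι ℂ .zero) (ι ℂ .zero * ι ℂ .plus)
  | three_zero : MinkRel q (ι ℂ .three * ι ℂ .zero) (ι ℂ .zero * ι ℂ .three)
  | minus_three : MinkRel q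
      (((q⁻¹ : ℝ) : ℂ) • (ι ℂ .minus * ι ℂ .three) - (q : ℂ) • (ι ℂ .three * ι ℂ .minus))
      (-((lam q : ℂ) • (ι ℂ .minus * ι ℂ .zero)))
  | three_plus : MinkRel q
      (((q⁻¹ : ℝ) : ℂ) • (ι ℂ .three * ι ℂ .plus) - (q : ℂ) • (ι ℂ .plus * ι ℂ .three))
      (-((lam q : ℂ) • (ι ℂ .plus * ι ℂ .zero)))
  | minus_plus : MinkRel q
      (ι ℂ .minus * ι ℂ .plus - ι ℂ .plus * ι ℂ .minus - (lam q : ℂ) • (ι ℂ .three * ι ℂ .three))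
      (-((lam q : ℂ) • (ι ℂ .three * ι ℂ .zero)))

/-- The algebra `𝒳` of quantum Minkowski space. -/
def Mink (q : ℝ) : Type := RingQuot (MinkRel q)

instance (q : ℝ) : Ring (Mink q) := inferInstanceAs (Ring (RingQuot (MinkRel q)))

instance (q : ℝ) : Algebra ℂ (Mink q) := inferInstanceAs (Algebra ℂ (RingQuot (MinkRel q)))

/-- The quotient map onto `𝒳`. -/
def mkMink (q : ℝ) : FreeAlgebra ℂ Idx →ₐ[ℂ] Mink q := RingQuot.mkAlgHom ℂ (MinkRel q)

/-- The coordinates `x_μ` of quantum Minkowski space. -/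
def coord (q : ℝ) (μ : Idx) : Mink q := mkMink q (ι ℂ μ)

/-- The four-square `x² = x₀² + q⁻¹ x₋x₊ + q x₊x₋ - x₃²`. -/
def fourSq (q : ℝ) : Mink q :=
  coord q .zero ^ 2 + ((q⁻¹ : ℝ) : ℂ) • (coord q .minus * coord q .plus)
    + (q : ℂ) • (coord q .plus * coord q .minus) - coord q .three ^ 2

end Algebras

/-- `α² = [2]² x₀² - 4 x²` for the indeterminate `α` of `𝒳[α]`, which is central there. -/
inductive SqrtRel (q : ℝ) : Polynomial (Mink q) → Polynomial (Mink q) → Prop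
  | sq : SqrtRel q (Polynomial.X ^ 2)
      (Polynomial.C (((qSym q 2 : ℂ) ^ 2) • coord q .zero ^ 2 - (4 : ℂ) • fourSq q))

/-- The extension `𝒳[α] / (α² - [2]² x₀² + 4 x²)` of `𝒳` by a central square root. -/
def MinkSqrt (q : ℝ) : Type := RingQuot (SqrtRel q)

instance (q : ℝ) : Ring (MinkSqrt q) := inferInstanceAs (Ring (RingQuot (SqrtRel q)))

instance (q : ℝ) : Algebra ℂ (MinkSqrt q) := inferInstanceAs (Algebra ℂ (RingQuot (SqrtRel q)))

/-- The quotient map from `𝒳[α]`. -/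
def mkSqrt (q : ℝ) : Polynomial (Mink q) →ₐ[ℂ] MinkSqrt q := RingQuot.mkAlgHom ℂ (SqrtRel q)

/-- The canonical map from `𝒳` to its extension. -/
def toSqrt (q : ℝ) : Mink q →ₐ[ℂ] MinkSqrt q :=
  (mkSqrt q).comp Polynomial.CAlgHom

/-- The adjoined central square root `α`. -/
def alpha (q : ℝ) : MinkSqrt q := mkSqrt q Polynomial.X

/-- A central indeterminate becomes an inverse of `α`. -/
inductive LocRel (q : ℝ) : Polynomial (MinkSqrt q) → Polynomial (MinkSqrt q) → Prop
  | inv : LocRel q (Polynomial.X * Polynomial.C (alpha q)) 1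

/-- The extension of quantum Minkowski space, localized at the central element `α`. -/
def MinkLoc (q : ℝ) : Type := RingQuot (LocRel q)

instance (q : ℝ) : Ring (MinkLoc q) := inferInstanceAs (Ring (RingQuot (LocRel q)))

instance (q : ℝ) : Algebra ℂ (MinkLoc q) := inferInstanceAs (Algebra ℂ (RingQuot (LocRel q)))

/-- The quotient map onto the localization. -/
def mkLoc (q : ℝ) : Polynomial (MinkSqrt q) →ₐ[ℂ] MinkLoc q := RingQuot.mkAlgHom ℂ (LocRel q)

/-- The localization map. -/
def toLoc (q : ℝ) : MinkSqrt q →ₐ[ℂ] MinkLoc q :=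
  (mkLoc q).comp Polynomial.CAlgHom

/-- The inverse `α⁻¹` of the adjoined square root. -/
def alphaInv (q : ℝ) : MinkLoc q := mkLoc q Polynomial.X

/-- The coordinates `x_μ` as elements of the extension. -/
def x (q : ℝ) (μ : Idx) : MinkSqrt q := toSqrt q (coord q μ)

/-- The square root `√(x₀² - 4 x² / [2]²) = α / [2]`. -/
def root (q : ℝ) : MinkSqrt q := ((qSym q 2 : ℂ))⁻¹ • alpha q

/-- The inverse of `√(x₀² - 4 x² / [2]²)`. -/
def rootInv (q : ℝ) : MinkLoc q := (qSym q 2 : ℂ) • alphaInv q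

/-- `ξ₊ = (x₀ + √(x₀² - 4 x² / [2]²)) / 2`. -/
def xiPlus (q : ℝ) : MinkSqrt q := (2⁻¹ : ℂ) • (x q .zero + root q)

/-- `ξ₋ = (x₀ - √(x₀² - 4 x² / [2]²)) / 2`. -/
def xiMinus (q : ℝ) : MinkSqrt q := (2⁻¹ : ℂ) • (x q .zero - root q)

/-- The root squares to `x₀² - 4 x² / [2]²`. -/
theorem root_sq (q : ℝ) (hq : qSym q 2 ≠ 0) :
    root q ^ 2 = x q .zero ^ 2 - (4 / (qSym q 2 : ℂ) ^ 2) • toSqrt q (fourSq q) := by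
  have h : alpha q ^ 2 = ((qSym q 2 : ℂ) ^ 2) • x q .zero ^ 2 - (4 : ℂ) • toSqrt q (fourSq q) := by
    have h1 : mkSqrt q (Polynomial.X ^ 2) = mkSqrt q (Polynomial.C
        (((qSym q 2 : ℂ) ^ 2) • coord q .zero ^ 2 - (4 : ℂ) • fourSq q)) :=
      RingQuot.mkAlgHom_rel ℂ SqrtRel.sq
    have h3 : ∀ a, mkSqrt q (Polynomial.C a) = toSqrt q a := fun _ => rfl
    rw [map_pow, h3, map_sub, map_smul, map_smul, map_pow] at h1
    exact h1
  have h2 : (qSym q 2 : ℂ) ≠ 0 := by exact_mod_cast hq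
  rw [root, smul_pow, h, smul_sub, smul_smul, smul_smul]
  congr 1
  · rw [← mul_pow, inv_mul_cancel₀ h2, one_pow, one_smul]
  · congr 1
    field_simp

/-- `rootInv` is the inverse of the root in the localization. -/
theorem root_mul_rootInv (q : ℝ) (hq : qSym q 2 ≠ 0) :
    toLoc q (root q) * rootInv q = 1 := by
  have h : toLoc q (alpha q) * alphaInv q = 1 := by
    have h1 : mkLoc q (Polynomial.X * Polynomial.C (alpha q)) = mkLoc q 1 :=
      RingQuot.mkAlgHom_rel ℂ LocRel.inv
    rw [Polynomial.X_mul_C, map_mul, map_one] at h1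
    exact h1
  have h2 : (qSym q 2 : ℂ) ≠ 0 := by exact_mod_cast hq
  rw [root, rootInv, map_smul, smul_mul_smul_comm, inv_mul_cancel₀ h2, h, one_smul]

/-! ### The `R`-matrix in the four-vector representation -/

/-- `ρ(E)` in the fundamental representation of `U_q(su₂)`; the entry in row `a` and column `c` is
the coefficient of the basis vector `a` in the image of the basis vector `c`. -/
def rhoE (q : ℝ) : Matrix Spin Spin ℂ := !![0, 0; ((√q : ℝ) : ℂ), 0]

/-- `ρ(F)` in the fundamental representation. -/
def rhoF (q : ℝ) : Matrix Spin Spin ℂ := !![0, ((√q : ℝ) : ℂ)⁻¹; 0, 0]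

/-- `q^{H ⊗ H / 2}` in the square of the fundamental representation, where `H = diag(-1, 1)`. -/
def rhoHH (q : ℝ) : Matrix (Spin × Spin) (Spin × Spin) ℂ :=
  Matrix.diagonal fun s => if s.1 = s.2 then ((√q : ℝ) : ℂ) else ((√q : ℝ) : ℂ)⁻¹

open scoped Kronecker in
/-- The universal `R`-matrix
`q^{H ⊗ H / 2} ∑ₙ q^{n(n-1)/2} (q - q⁻¹)ⁿ / [n]! (Eⁿ ⊗ Fⁿ)` of `U_q(su₂)` in the square of the
fundamental representation; the terms with `n ≥ 2` vanish there since `ρ(E)² = 0`. -/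
def Rhalf (q : ℝ) : Matrix (Spin × Spin) (Spin × Spin) ℂ :=
  rhoHH q * (1 + (lam q : ℂ) • (rhoE q ⊗ₖ rhoF q))

/-- The matrix of `R_II = R₄₁⁻¹ R₁₃ R₂₄ R₂₃` in the square of the spin-`(1/2,1/2)` representation.
The first two of the four tensor legs are those of the first spin-`(1/2,1/2)` factor, the last two
are those of the second one; `a b c d` are the values of the four legs between the factors. -/
def RIIspin (q : ℝ) : Matrix ((Spin × Spin) × (Spin × Spin)) ((Spin × Spin) × (Spin × Spin)) ℂ :=
  fun s t => ∑ a : Spin, ∑ b : Spin, ∑ c : Spin, ∑ d : Spin,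
    (Rhalf q)⁻¹ (s.2.2, s.1.1) (d, a) * Rhalf q (a, s.2.1) (t.1.1, c)
      * Rhalf q (s.1.2, d) (b, t.2.2) * Rhalf q (b, c) (t.1.2, t.2.1)

/-- The change of basis `x_{ij} = ∑_μ x_μ C^μ_{ij}`, that is `x_{--} = [2]^{1/2} x₋`,
`x_{-+} = q^{1/2} (x₃ - x₀)`, `x_{+-} = q^{-1/2} x₃ + q^{3/2} x₀`, `x_{++} = [2]^{1/2} x₊`. -/
def spinOfVec (q : ℝ) : Matrix Idx (Spin × Spin) ℂ
  | .minus, (0, 0) => ((√(qSym q 2) : ℝ) : ℂ)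
  | .three, (0, 1) => ((√q : ℝ) : ℂ)
  | .zero, (0, 1) => -((√q : ℝ) : ℂ)
  | .three, (1, 0) => ((√q : ℝ) : ℂ)⁻¹
  | .zero, (1, 0) => ((√q : ℝ) : ℂ) ^ 3
  | .plus, (1, 1) => ((√(qSym q 2) : ℝ) : ℂ)
  | _, _ => 0

/-- The inverse change of basis `x_μ = ∑_{ij} x_{ij} (C⁻¹)^{ij}_μ`. -/
def vecOfSpin (q : ℝ) : Matrix (Spin × Spin) Idx ℂ
  | (0, 0), .minus => ((√(qSym q 2) : ℝ) : ℂ)⁻¹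
  | (0, 1), .three => ((√q : ℝ) : ℂ) / (qSym q 2 : ℂ)
  | (1, 0), .three => ((√q : ℝ) : ℂ)⁻¹ / (qSym q 2 : ℂ)
  | (0, 1), .zero => -((√q : ℝ) : ℂ)⁻¹ ^ 3 / (qSym q 2 : ℂ)
  | (1, 0), .zero => ((√q : ℝ) : ℂ)⁻¹ / (qSym q 2 : ℂ)
  | (1, 1), .plus => ((√(qSym q 2) : ℝ) : ℂ)⁻¹
  | _, _ => 0

theorem qSym_two {q : ℝ} (h0 : 0 < q) (h1 : q ≠ 1) : qSym q 2 = q + q⁻¹ := by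
  have h : q - q⁻¹ ≠ 0 := by
    intro h
    have h2 : q * q = 1 := by
      have h3 : q = q⁻¹ := by linarith
      nth_rewrite 2 [h3]
      exact mul_inv_cancel₀ h0.ne'
    exact h1 (by nlinarith)
  rw [qSym, div_eq_iff h]
  ring

/-- `spinOfVec` and `vecOfSpin` are inverse to each other. -/
theorem spinOfVec_mul_vecOfSpin {q : ℝ} (h0 : 0 < q) (h1 : q ≠ 1) :
    spinOfVec q * vecOfSpin q = 1 := by
  have hs : 0 < √q := Real.sqrt_pos.2 h0
  have hq : q = √q ^ 2 := (Real.sq_sqrt h0.le).symm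
  have h2 : 0 < qSym q 2 := by rw [qSym_two h0 h1]; positivity
  have hr : 0 < √(qSym q 2) := Real.sqrt_pos.2 h2
  have hq2 : ((qSym q 2 : ℝ) : ℂ) = (√q : ℂ) ^ 2 + ((√q : ℂ) ^ 2)⁻¹ := by
    rw [qSym_two h0 h1]
    nth_rewrite 1 2 [hq]
    push_cast
    ring
  have hs' : ((√q : ℝ) : ℂ) ≠ 0 := by exact_mod_cast hs.ne'
  have hr' : ((√(qSym q 2) : ℝ) : ℂ) ≠ 0 := by exact_mod_cast hr.ne'
  have h2' : ((√q : ℂ)) ^ 2 + ((√q : ℂ) ^ 2)⁻¹ ≠ 0 := by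
    rw [← hq2]; exact_mod_cast h2.ne'
  have h3' : ((√q : ℂ)) ^ 4 + 1 ≠ 0 := by
    intro h
    apply h2'
    field_simp
    linear_combination h
  ext μ ν
  cases μ <;> cases ν <;>
    simp [Matrix.mul_apply, Fintype.sum_prod_type, Fin.sum_univ_two, spinOfVec, vecOfSpin, hr'] <;> rw [hq2] <;> field_simp <;> ring

/-- The entries `R_II^{βμ}_{αν}` with respect to the four-vector basis, in row `(β, μ)` and column
`(α, ν)`. -/
def RII (q : ℝ) (β μ α ν : Idx) : ℂ :=
  ∑ s : Spin × Spin, ∑ t : Spin × Spin, ∑ s' : Spin × Spin, ∑ t' : Spin × Spin,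
    spinOfVec q β s * spinOfVec q μ t * RIIspin q (s, t) (s', t')
      * vecOfSpin q s' α * vecOfSpin q t' ν

/-- The matrix `L_{x_α}` with entries `L^μ_ν ▷ x_α = ∑_β x_β R_II^{βμ}_{αν}`. -/
def Lcoord (q : ℝ) (α : Idx) : Matrix Idx Idx (MinkLoc q) :=
  fun μ ν => ∑ β : Idx, RII q β μ α ν • toLoc q (x q β)

/-! ### The differential calculus -/

/-- `(L_{x₀} - b) / √(b² - c)`, where `b = [2] x₀ / 2`, `c = x₀² + λ² x² / [2]²` and
`√(b² - c) = (λ / 2) √(x₀² - 4 x² / [2]²)`. -/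
def signMat (q : ℝ) : Matrix Idx Idx (MinkLoc q) :=
  fun μ ν => ((2 / lam q : ℝ) : ℂ) •
    (rootInv q * (Lcoord q .zero μ ν
      - if μ = ν then ((qSym q 2 / 2 : ℝ) : ℂ) • toLoc q (x q .zero) else 0))

/-- `Π₊ = (1 + (L_{x₀} - b) / √(b² - c)) / 2`. -/
def PiPlus (q : ℝ) : Matrix Idx Idx (MinkLoc q) := (2⁻¹ : ℂ) • (1 + signMat q)

/-- `Π₋ = (1 - (L_{x₀} - b) / √(b² - c)) / 2`. -/
def PiMinus (q : ℝ) : Matrix Idx Idx (MinkLoc q) := (2⁻¹ : ℂ) • (1 - signMat q)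

/-- `√(τ₊² - 4 x² / [2]²) = (λ x₀ + [2] √(x₀² - 4 x² / [2]²)) / 2`. -/
def rootTauPlus (q : ℝ) : MinkSqrt q :=
  (2⁻¹ : ℂ) • ((lam q : ℂ) • x q .zero + (qSym q 2 : ℂ) • root q)

/-- `√(τ₋² - 4 x² / [2]²) = (-λ x₀ + [2] √(x₀² - 4 x² / [2]²)) / 2`. -/
def rootTauMinus (q : ℝ) : MinkSqrt q :=
  (2⁻¹ : ℂ) • (-((lam q : ℂ) • x q .zero) + (qSym q 2 : ℂ) • root q)

/-- The covariant first order differential calculus on the extended quantum Minkowski space: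
`twist f` is the matrix of all `κ L^μ_ν ▷ f`, and `grad f` is the vector of all `∂^μ ▷ f`. That
`κ` is group-like and `L` comultiplicative makes `twist` multiplicative; the coproduct
`Δ(∂^μ) = ∂^μ ⊗ 1 + κ L^μ_ν ⊗ ∂^ν` is the twisted Leibniz rule. On the square root, `κ L` acts by
functional calculus in `L_{x₀}`: it takes the root to
`q √(τ₊² - 4 x² / [2]²) Π₊ + q √(τ₋² - 4 x² / [2]²) Π₋`.
The gradient of the square root is not prescribed. -/
@[ext]
structure Calculus (q : ℝ) where
  twist : MinkSqrt q →ₐ[ℂ] Matrix Idx Idx (MinkLoc q)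
  grad : MinkSqrt q →ₗ[ℂ] (Idx → MinkLoc q)
  twist_coord : ∀ α, twist (x q α) = (q : ℂ) • Lcoord q α
  twist_root : twist (root q) =
    (q : ℂ) • (toLoc q (rootTauPlus q) • PiPlus q + toLoc q (rootTauMinus q) • PiMinus q)
  grad_coord : ∀ α, grad (x q α) = Pi.single α 1
  grad_mul : ∀ f g μ, grad (f * g) μ = grad f μ * toLoc q g + ∑ ν, twist f μ ν * grad g ν

/-! ### Ordered polynomials and partial Jackson derivatives -/

/-- Ordered polynomials in two variables: formal combinations of the ordered monomials
`X₁^k X₂^l`, indexed by `(k, l)`. -/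
abbrev OrdPoly : Type := (ℕ × ℕ) →₀ ℂ

/-- The value of an ordered polynomial at two elements of an algebra. -/
def OrdPoly.eval {A : Type*} [Ring A] [Algebra ℂ A] (a b : A) (f : OrdPoly) : A :=
  f.sum fun k z => z • (a ^ k.1 * b ^ k.2)

/-- The partial Jackson `q²`-derivative with respect to the first variable. -/
def OrdPoly.jackson₁ (q : ℝ) (f : OrdPoly) : OrdPoly :=
  f.sum fun k z => Finsupp.single (k.1 - 1, k.2) (z * (qNum q k.1 : ℂ))

/-- The partial Jackson `q²`-derivative with respect to the second variable. -/
def OrdPoly.jackson₂ (q : ℝ) (f : OrdPoly) : OrdPoly :=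
  f.sum fun k z => Finsupp.single (k.1, k.2 - 1) (z * (qNum q k.2 : ℂ))

end

end QMinkowski

/-!
A calculus is the same thing as an algebra homomorphism `f ↦ (M f, ∇ f; 0, f)` from the extended
quantum Minkowski space into block triangular `5 × 5` matrices over its localization
(`Calculus.toBlock`): multiplicativity of the diagonal block and the twisted Leibniz rule together
say that the block matrices multiply. Existence and uniqueness thus reduce to the universal property
of the algebra (`exists_algHom`).

For existence, the coordinates go to `(q L_{x_α}, e_α; 0, x_α)` and the root `s` to
`(M s, S e₀; 0, s)`, where `S = (L_{x₀} - b) / √(b² - c) = Π₊ - Π₋`. It has to be checked that these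
matrices satisfy the relations of the coordinates (`isMinkFamily_coordBlock`), that the matrix of
`s` commutes with the others (`commute_rootBlock`), and that its square is the matrix of
`x₀² - 4 x² / [2]²` (`rootBlock_mul_rootBlock`). Once the matrices `L_{x_α}` are computed from
`R_II` (`RII_eq_fourVecL`), all of this comes down to identities between quadratic expressions in
the coordinates, which are decided by normal ordering; the quadratic equation `S² = 1` is one of
them (`rootMat_mul_rootMat`).

For uniqueness, the one datum that is not prescribed is the gradient of `s`. It is forced to be
`S e₀`, because `s` commutes with `x₀` and `s²` is a polynomial in the coordinates
(`eq_signOf_of_block`). This gives `∇ ξ± = Π± ∇ x₀`, and these are eigenvectors: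
`M ξ₊ = ξ₊ (q² Π₊ + Π₋)` and `M ξ₋ = ξ₋ (Π₊ + q² Π₋)` act on `∇ ξ₊` and `∇ ξ₋` by `q²` or `1` times
the central element `ξ±`. The Leibniz rule then sums up to the `q²`-numbers of the Jackson
derivatives (`Calculus.grad_monomial`).
-/

namespace QMinkowski

noncomputable section

open Matrix Finset
open scoped Kronecker

/-! ### The `R`-matrix in the four-vector basis -/

theorem lam_ofReal (q : ℝ) : (lam q : ℂ) = (q : ℂ) - (q : ℂ)⁻¹ := by
  simp [lam]

theorem sqrt_ofReal_ne_zero {q : ℝ} (h0 : 0 < q) : ((√q : ℝ) : ℂ) ≠ 0 := by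
  exact_mod_cast (Real.sqrt_pos.2 h0).ne'

theorem sqrt_ofReal_sq {q : ℝ} (h0 : 0 < q) : ((√q : ℝ) : ℂ) ^ 2 = q := by
  exact_mod_cast Real.sq_sqrt h0.le

/-- The rows of the `R`-matrix, as functionals on two-index families; each has at most two nonzero
entries. -/
theorem sum_Rhalf_mul {q : ℝ} (h0 : 0 < q) (f : Spin → Spin → ℂ) :
    (∑ c, ∑ d, Rhalf q (0, 0) (c, d) * f c d = (√q : ℂ) * f 0 0) ∧
    (∑ c, ∑ d, Rhalf q (0, 1) (c, d) * f c d = (√q : ℂ)⁻¹ * f 0 1) ∧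
    (∑ c, ∑ d, Rhalf q (1, 0) (c, d) * f c d =
      (√q : ℂ)⁻¹ * f 1 0 + (lam q : ℂ) * (√q : ℂ)⁻¹ * f 0 1) ∧
    (∑ c, ∑ d, Rhalf q (1, 1) (c, d) * f c d = (√q : ℂ) * f 1 1) := by
  have := sqrt_ofReal_ne_zero h0
  refine ⟨?_, ?_, ?_, ?_⟩ <;>
    simp [Rhalf, rhoHH, Matrix.diagonal_mul, Matrix.one_apply, rhoE, rhoF, Fin.sum_univ_two,
      Matrix.kroneckerMap_apply, this]
  ring

/-- The rows of the inverse `R`-matrix, as functionals. The inverse is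
`(1 - λ E ⊗ F) q^{-H ⊗ H / 2}` because `E² = 0`. -/
theorem sum_Rhalf_inv_mul {q : ℝ} (h0 : 0 < q) (f : Spin → Spin → ℂ) :
    (∑ c, ∑ d, (Rhalf q)⁻¹ (0, 0) (c, d) * f c d = (√q : ℂ)⁻¹ * f 0 0) ∧
    (∑ c, ∑ d, (Rhalf q)⁻¹ (0, 1) (c, d) * f c d = (√q : ℂ) * f 0 1) ∧
    (∑ c, ∑ d, (Rhalf q)⁻¹ (1, 0) (c, d) * f c d =
      (√q : ℂ) * f 1 0 - (lam q : ℂ) * (√q : ℂ) * f 0 1) ∧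
    (∑ c, ∑ d, (Rhalf q)⁻¹ (1, 1) (c, d) * f c d = (√q : ℂ)⁻¹ * f 1 1) := by
  have ht := sqrt_ofReal_ne_zero h0
  have h : Rhalf q * ((1 - (lam q : ℂ) • (rhoE q ⊗ₖ rhoF q)) *
      diagonal fun s : Spin × Spin =>
        if s.1 = s.2 then ((√q : ℝ) : ℂ)⁻¹ else ((√q : ℝ) : ℂ)) = 1 := by
    have h1 : (rhoE q ⊗ₖ rhoF q) * (rhoE q ⊗ₖ rhoF q) = 0 := by
      have h3 : rhoE q * rhoE q = 0 := by
        ext i j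
        fin_cases i <;> fin_cases j <;> simp [rhoE, Matrix.mul_apply]
      rw [← Matrix.mul_kronecker_mul, h3, Matrix.zero_kronecker]
    have h2 : (1 + (lam q : ℂ) • (rhoE q ⊗ₖ rhoF q)) *
        (1 - (lam q : ℂ) • (rhoE q ⊗ₖ rhoF q)) = 1 := by
      simp [add_mul, mul_sub, h1]
    rw [Rhalf, Matrix.mul_assoc, ← Matrix.mul_assoc (1 + _), h2, Matrix.one_mul, rhoHH,
      Matrix.diagonal_mul_diagonal, ← Matrix.diagonal_one]
    congr 1
    funext s
    split_ifs <;> simp [ht]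
  rw [Matrix.inv_eq_right_inv h]
  refine ⟨?_, ?_, ?_, ?_⟩ <;>
    simp [Matrix.mul_diagonal, Matrix.one_apply, rhoE, rhoF, Fin.sum_univ_two,
      Matrix.kroneckerMap_apply, ht]
  ring

/-- A row of `R_II`, evaluated one `R`-matrix after the other, which keeps every intermediate sum at
most two terms long. -/
theorem sum_RIIspin_mul (q : ℝ) (s t : Spin × Spin) (f : Spin → Spin → Spin → Spin → ℂ) :
    ∑ a', ∑ b', ∑ c', ∑ d', RIIspin q (s, t) ((a', b'), (c', d')) * f a' b' c' d' =
      ∑ d, ∑ a, (Rhalf q)⁻¹ (t.2, s.1) (d, a) * ∑ a', ∑ c, Rhalf q (a, t.1) (a', c) *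
        ∑ b, ∑ d', Rhalf q (s.2, d) (b, d') * ∑ b', ∑ c', Rhalf q (b, c) (b', c') *
          f a' b' c' d' := by
  simp only [RIIspin, Fin.sum_univ_two]
  ring


/-- Nested form of the change of basis, so that the sparse rows of `spinOfVec` and of `R_II` can be
inserted one at a time. -/
theorem RII_eq (q : ℝ) (β μ α ν : Idx) :
    RII q β μ α ν = ∑ s, spinOfVec q β s * ∑ t, spinOfVec q μ t *
      ∑ a', ∑ b', ∑ c', ∑ d', RIIspin q (s, t) ((a', b'), (c', d')) *
        (vecOfSpin q (a', b') α * vecOfSpin q (c', d') ν) := by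
  simp only [RII, Fintype.sum_prod_type (f := fun s' : Spin × Spin => ∑ _, _), Finset.mul_sum]
  simp only [Fintype.sum_prod_type, mul_assoc]

/-- The polynomial matrices `q³ (q² + 1) L_{x_α}`, in row `μ` and column `ν`, for a family `x` in
any module. The factor `q³ (q² + 1) = q⁴ [2]` clears all denominators. Evaluated at the `β`-th unit
vector of `ℂ^Idx` they are, up to that factor, the coefficients `R_II^{βμ}_{αν}`. -/
def fourVecL {M : Type*} [AddCommGroup M] [Module ℂ M] (q : ℂ) (x : Idx → M) :
    Idx → Matrix Idx Idx M
  | .zero, .zero, .zero => (q ^ 6 + q ^ 2) • x .zero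
  | .zero, .zero, .minus => (q ^ 6 - q ^ 4) • x .minus
  | .zero, .zero, .plus => (q ^ 6 - q ^ 4) • x .plus
  | .zero, .zero, .three => (q ^ 6 - q ^ 4) • x .three
  | .zero, .minus, .zero => (-q ^ 3 + q) • x .plus
  | .zero, .minus, .minus => (q ^ 6 + q ^ 2) • x .zero + (q ^ 4 - q ^ 2) • x .three
  | .zero, .minus, .plus => 0
  | .zero, .minus, .three => (q ^ 5 - q ^ 3) • x .plus
  | .zero, .plus, .zero => (-q ^ 5 + q ^ 3) • x .minus
  | .zero, .plus, .minus => 0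
  | .zero, .plus, .plus => (q ^ 6 + q ^ 2) • x .zero + (-q ^ 6 + q ^ 4) • x .three
  | .zero, .plus, .three => (-q ^ 5 + q ^ 3) • x .minus
  | .zero, .three, .zero => (q ^ 4 - q ^ 2) • x .three
  | .zero, .three, .minus => (-q ^ 6 + q ^ 4) • x .minus
  | .zero, .three, .plus => (q ^ 4 - q ^ 2) • x .plus
  | .zero, .three, .three => (q ^ 6 + q ^ 2) • x .zero + (-q ^ 6 + 2 * q ^ 4 - q ^ 2) • x .three
  | .minus, .zero, .zero => (q ^ 6 + q ^ 2) • x .minus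
  | .minus, .zero, .minus => 0
  | .minus, .zero, .plus => (-q ^ 3 + q) • x .zero + (-q ^ 5 + q ^ 3) • x .three
  | .minus, .zero, .three => (-q ^ 4 + q ^ 2) • x .minus
  | .minus, .minus, .zero => (q ^ 6 - q ^ 4) • x .zero + (q ^ 4 - q ^ 2) • x .three
  | .minus, .minus, .minus => (q ^ 6 + q ^ 4) • x .minus
  | .minus, .minus, .plus => (q ^ 6 - q ^ 4 - q ^ 2 + 1) • x .plus
  | .minus, .minus, .three => (-q ^ 4 + q ^ 2) • x .zero + (q ^ 6 + q ^ 4 - 2 * q ^ 2) • x .three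
  | .minus, .plus, .zero => 0
  | .minus, .plus, .minus => 0
  | .minus, .plus, .plus => (q ^ 4 + q ^ 2) • x .minus
  | .minus, .plus, .three => 0
  | .minus, .three, .zero => (-q ^ 6 + q ^ 4) • x .minus
  | .minus, .three, .minus => 0
  | .minus, .three, .plus => (-q ^ 5 + q ^ 3) • x .zero + (2 * q ^ 5 - q ^ 3 - q) • x .three
  | .minus, .three, .three => (2 * q ^ 4) • x .minus
  | .plus, .zero, .zero => (q ^ 6 + q ^ 2) • x .plus
  | .plus, .zero, .minus => (-q ^ 5 + q ^ 3) • x .zero + (q ^ 5 - q ^ 3) • x .three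
  | .plus, .zero, .plus => 0
  | .plus, .zero, .three => (q ^ 6 - q ^ 4) • x .plus
  | .plus, .minus, .zero => 0
  | .plus, .minus, .minus => (q ^ 4 + q ^ 2) • x .plus
  | .plus, .minus, .plus => 0
  | .plus, .minus, .three => 0
  | .plus, .plus, .zero => (q ^ 6 - q ^ 4) • x .zero + (-q ^ 6 + q ^ 4) • x .three
  | .plus, .plus, .minus => 0
  | .plus, .plus, .plus => (q ^ 6 + q ^ 4) • x .plus
  | .plus, .plus, .three => (q ^ 6 - q ^ 4) • x .zero + (-q ^ 6 + q ^ 4) • x .three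
  | .plus, .three, .zero => (q ^ 4 - q ^ 2) • x .plus
  | .plus, .three, .minus => (q ^ 5 - q ^ 3) • x .zero + (-q ^ 5 + q ^ 3) • x .three
  | .plus, .three, .plus => 0
  | .plus, .three, .three => (2 * q ^ 4) • x .plus
  | .three, .zero, .zero => (q ^ 6 + q ^ 2) • x .three
  | .three, .zero, .minus => (q ^ 6 - q ^ 4) • x .minus
  | .three, .zero, .plus => (-q ^ 4 + q ^ 2) • x .plus
  | .three, .zero, .three => (q ^ 4 - q ^ 2) • x .zero + (q ^ 6 - 2 * q ^ 4 + q ^ 2) • x .three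
  | .three, .minus, .zero => (q ^ 5 - q ^ 3) • x .plus
  | .three, .minus, .minus => (q ^ 6 - q ^ 4) • x .zero + (2 * q ^ 4) • x .three
  | .three, .minus, .plus => 0
  | .three, .minus, .three => (2 * q ^ 5 - q ^ 3 - q) • x .plus
  | .three, .plus, .zero => (-q ^ 5 + q ^ 3) • x .minus
  | .three, .plus, .minus => 0
  | .three, .plus, .plus => (-q ^ 4 + q ^ 2) • x .zero + (2 * q ^ 4) • x .three
  | .three, .plus, .three => (-q ^ 5 + q ^ 3) • x .minus
  | .three, .three, .zero => (q ^ 6 - q ^ 4) • x .zero + (-q ^ 6 + 2 * q ^ 4 - q ^ 2) • x .three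
  | .three, .three, .minus => (-q ^ 6 + q ^ 4) • x .minus
  | .three, .three, .plus => (q ^ 6 + q ^ 4 - 2 * q ^ 2) • x .plus
  | .three, .three, .three => (q ^ 6 - 2 * q ^ 4 + q ^ 2) • x .zero +
      (-q ^ 6 + 4 * q ^ 4 - q ^ 2) • x .three

theorem sum_spinOfVec_mul (q : ℝ) (g : Spin × Spin → ℂ) :
    (∑ s, spinOfVec q .zero s * g s = (√q : ℂ) ^ 3 * g (1, 0) - (√q : ℂ) * g (0, 1)) ∧
    (∑ s, spinOfVec q .minus s * g s = (√(qSym q 2) : ℂ) * g (0, 0)) ∧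
    (∑ s, spinOfVec q .plus s * g s = (√(qSym q 2) : ℂ) * g (1, 1)) ∧
    (∑ s, spinOfVec q .three s * g s = (√q : ℂ) * g (0, 1) + (√q : ℂ)⁻¹ * g (1, 0)) := by
  refine ⟨?_, ?_, ?_, ?_⟩ <;> simp [Fintype.sum_prod_type, Fin.sum_univ_two, spinOfVec]
  ring

set_option maxHeartbeats 4000000 in
/-- The explicit form of `R_II` in the four-vector basis. Although the change of basis contains `√q`
and `√[2]`, only integral powers of `q` and `[2]` survive. -/
theorem RII_eq_fourVecL {q : ℝ} (h0 : 0 < q) (h1 : q ≠ 1) (β μ α ν : Idx) :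
    RII q β μ α ν =
      fourVecL (q : ℂ) (Pi.single β (1 : ℂ)) α μ ν / ((q : ℂ) ^ 3 * ((q : ℂ) ^ 2 + 1)) := by
  have ht := sqrt_ofReal_ne_zero h0
  have hQ := sqrt_ofReal_sq h0
  have h2 : 0 < qSym q 2 := by rw [qSym_two h0 h1]; positivity
  have hw : ((√(qSym q 2) : ℝ) : ℂ) ^ 2 = (qSym q 2 : ℂ) := by exact_mod_cast Real.sq_sqrt h2.le
  -- Writing `√[2]⁻¹` as `√[2] / [2]` leaves only even powers of `√[2]`.
  have hwi : ((√(qSym q 2) : ℝ) : ℂ)⁻¹ = (√(qSym q 2) : ℂ) * (qSym q 2 : ℂ)⁻¹ := by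
    have : (√(qSym q 2) : ℂ) ≠ 0 := by exact_mod_cast (Real.sqrt_pos.2 h2).ne'
    rw [← hw]
    field_simp
  have hD : (qSym q 2 : ℂ) = ((√q : ℂ) ^ 4 + 1) / (√q : ℂ) ^ 2 := by
    rw [qSym_two h0 h1]
    push_cast
    rw [← hQ]
    field_simp
  have hD0 : (√q : ℂ) ^ 4 + 1 ≠ 0 := by
    intro h
    rw [h, zero_div] at hD
    exact h2.ne' (by exact_mod_cast hD)
  have hD1 : 1 + (√q : ℂ) ^ 4 ≠ 0 := by rwa [add_comm]
  rw [hD] at hw hwi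
  have hw4 : ((√(qSym q 2) : ℝ) : ℂ) ^ 4 = (((√q : ℂ) ^ 4 + 1) / (√q : ℂ) ^ 2) ^ 2 := by
    rw [← hw]; ring
  -- The table is hidden until the indices are concrete, where unfolding it is cheap.
  generalize hf : fourVecL (q : ℂ) (Pi.single β (1 : ℂ)) = K
  rw [RII_eq]
  cases β <;> cases μ <;>
    simp only [↓sum_spinOfVec_mul, ↓sum_RIIspin_mul, ↓sum_Rhalf_mul h0, ↓sum_Rhalf_inv_mul h0] <;>
    cases α <;> cases ν <;> rw [← hf] <;> dsimp only [fourVecL, vecOfSpin] <;>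
    simp only [↓mul_zero, ↓zero_mul, hD, hwi, lam_ofReal, Pi.single_apply, reduceCtorEq, if_true,
      if_false, smul_eq_mul, mul_one, add_zero, zero_add, sub_zero, zero_sub, zero_div, ← hQ] <;>
    ring_nf <;> (try simp only [hw, hw4]) <;> field_simp <;> ring

/-! ### Quadratic identities for the matrices `L` -/

/-- The relations of quantum Minkowski space, for a family of four elements of an algebra, solved
for the products that are not in the normal order `x₀, x₊, x₃, x₋`. -/
structure IsMinkFamily {A : Type*} [Ring A] [Algebra ℂ A] (q : ℂ) (x : Idx → A) : Prop where
  minus_zero : x .minus * x .zero = x .zero * x .minus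
  plus_zero : x .plus * x .zero = x .zero * x .plus
  three_zero : x .three * x .zero = x .zero * x .three
  minus_three : x .minus * x .three =
    q ^ 2 • (x .three * x .minus) - (q ^ 2 - 1) • (x .zero * x .minus)
  three_plus : x .three * x .plus =
    q ^ 2 • (x .plus * x .three) - (q ^ 2 - 1) • (x .zero * x .plus)
  minus_plus : x .minus * x .plus =
    x .plus * x .minus + (q - q⁻¹) • (x .three * x .three - x .zero * x .three)

/-- The matrices `L_{x_α}` for a family `x` in an algebra. -/
def vecL {A : Type*} [Ring A] [Algebra ℂ A] (q : ℂ) (x : Idx → A) (α : Idx) : Matrix Idx Idx A :=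
  (q ^ 3 * (q ^ 2 + 1))⁻¹ • fourVecL q x α

/-- The matrix `(2 / λ) (L_{x₀} - [2] x₀ / 2)`, which is `√(x₀² - 4 x² / [2]²)` times the sign of
`L_{x₀} - b`; unlike the sign it is linear in the coordinates. -/
def rootMat {A : Type*} [Ring A] [Algebra ℂ A] (q : ℂ) (x : Idx → A) : Matrix Idx Idx A :=
  (2 / (q - q⁻¹)) • (vecL q x .zero - ((q + q⁻¹) / 2) • Matrix.diagonal fun _ => x .zero)

/-- The square `x₀² - 4 x² / [2]²` of the root. -/
def rootSq {A : Type*} [Ring A] [Algebra ℂ A] (q : ℂ) (x : Idx → A) : A :=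
  x .zero * x .zero - (4 / (q + q⁻¹) ^ 2) • (x .zero * x .zero + q⁻¹ • (x .minus * x .plus) +
    q • (x .plus * x .minus) - x .three * x .three)

section Quadratic

variable {A : Type*} [Ring A] [Algebra ℂ A] {q : ℂ} {x : Idx → A}

theorem isMinkFamily_smul {c : ℂ} (h : IsMinkFamily q x) : IsMinkFamily q (fun α => c • x α) := by
  constructor <;> simp only [smul_mul_smul_comm, h.minus_zero, h.plus_zero, h.three_zero,
    h.minus_three, h.three_plus, h.minus_plus] <;> module

set_option maxHeartbeats 4000000 in
/-- The matrices `L_{x_α}` satisfy the relations of the coordinates; these are homogeneous, so the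
common factor in `fourVecL` does not matter. By normal ordering, every entry becomes an identity
between the coefficients of the ten ordered quadratic monomials. -/
theorem isMinkFamily_fourVecL (h : IsMinkFamily q x) (hq : q ≠ 0) :
    IsMinkFamily q (fourVecL q x) := by
  -- Distributivity is used in `A` only, so that the scalar coefficients are not multiplied out.
  constructor <;> ext μ ν <;>
    simp only [Matrix.mul_apply, Matrix.add_apply, Matrix.smul_apply, Matrix.sub_apply,
      Idx.sum_univ] <;>
    cases μ <;> cases ν <;> dsimp only [fourVecL] <;>
    simp only [add_zero, zero_add, mul_zero, zero_mul, @add_mul A, @mul_add A,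
      smul_mul_smul_comm, h.minus_zero, h.plus_zero, h.three_zero,
      h.minus_three, h.three_plus, h.minus_plus, smul_add, smul_sub, smul_smul, smul_zero,
      sub_zero] <;>
    match_scalars <;> field_simp <;> ring

theorem isMinkFamily_vecL (h : IsMinkFamily q x) (hq : q ≠ 0) :
    IsMinkFamily q (vecL q x) :=
  isMinkFamily_smul (isMinkFamily_fourVecL h hq)

set_option maxHeartbeats 4000000 in
/-- The quadratic equation `(L_{x₀} - b)² = b² - c` for `L_{x₀}`. -/
theorem rootMat_mul_rootMat (h : IsMinkFamily q x) (hq : q ≠ 0) (hq1 : q ^ 2 - 1 ≠ 0)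
    (hq2 : q ^ 2 + 1 ≠ 0) :
    rootMat q x * rootMat q x = Matrix.diagonal fun _ => rootSq q x := by
  ext μ ν
  simp only [Matrix.mul_apply, Matrix.smul_apply, Matrix.sub_apply, Matrix.diagonal_apply,
    Idx.sum_univ, rootMat, rootSq, vecL]
  cases μ <;> cases ν <;> dsimp only [fourVecL] <;>
    simp only [reduceCtorEq, if_true, if_false, add_zero, mul_zero, zero_mul,
      @add_mul A, @mul_add A, @sub_mul A, @mul_sub A, smul_mul_assoc, mul_smul_comm,
      h.minus_zero, h.plus_zero, h.three_zero,
      h.minus_three, h.three_plus, h.minus_plus, smul_add, smul_sub, smul_smul, smul_zero,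
      sub_zero] <;>
    match_scalars <;> field_simp <;> ring

set_option maxHeartbeats 4000000 in
/-- The gradients of `s x_α` and of `x_α s` agree for the root `s`; this is the equation multiplied
by `s`, which makes it quadratic in the coordinates. -/
theorem rootMat_col_comm (h : IsMinkFamily q x) (hq : q ≠ 0) (hq1 : q ^ 2 - 1 ≠ 0)
    (hq2 : q ^ 2 + 1 ≠ 0) (μ α : Idx) :
    rootMat q x μ .zero * x α + (q / 2) • ((q + q⁻¹) • (Matrix.diagonal fun _ => rootSq q x) μ α +
      (q - q⁻¹) • (x .zero * rootMat q x μ α)) =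
    (Matrix.diagonal fun _ => rootSq q x) μ α +
      ∑ ν, (q • vecL q x α) μ ν * rootMat q x ν .zero := by
  simp only [Matrix.smul_apply, Matrix.sub_apply, Matrix.diagonal_apply, Idx.sum_univ, rootMat,
    rootSq, vecL]
  cases μ <;> cases α <;> dsimp only [fourVecL] <;>
    simp only [reduceCtorEq, if_true, if_false, add_zero, zero_add, mul_zero, zero_mul,
      @add_mul A, @mul_add A, @sub_mul A, @mul_sub A, smul_mul_assoc, mul_smul_comm,
      h.minus_zero, h.plus_zero, h.three_zero,
      h.minus_three, h.three_plus, h.minus_plus, smul_add, smul_sub, smul_smul, smul_zero,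
      sub_zero] <;>
    match_scalars <;> field_simp <;> ring

set_option maxHeartbeats 4000000 in
/-- The matrix that belongs to `x₀² - 4 x² / [2]²` is, up to `q²`, the square of the matrix
prescribed for the root. -/
theorem rootSq_vecL (h : IsMinkFamily q x) (hq : q ≠ 0) (hq1 : q ^ 2 - 1 ≠ 0)
    (hq2 : q ^ 2 + 1 ≠ 0) :
    rootSq q (vecL q x) = (Matrix.diagonal fun _ =>
      (4⁻¹ : ℂ) • ((q + q⁻¹) ^ 2 • rootSq q x + (q - q⁻¹) ^ 2 • (x .zero * x .zero))) +
      ((q + q⁻¹) * (q - q⁻¹) / 2) • (x .zero • rootMat q x) := by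
  ext μ ν
  simp only [Matrix.mul_apply, Matrix.smul_apply, Matrix.sub_apply, Matrix.add_apply,
    Matrix.diagonal_apply, smul_eq_mul, Idx.sum_univ, rootMat, rootSq, vecL]
  cases μ <;> cases ν <;> dsimp only [fourVecL] <;>
    simp only [reduceCtorEq, if_true, if_false, add_zero, zero_add, mul_zero, zero_mul,
      @add_mul A, @mul_add A, @mul_sub A, smul_mul_assoc, mul_smul_comm,
      h.minus_zero, h.plus_zero, h.three_zero,
      h.minus_three, h.three_plus, h.minus_plus, smul_add, smul_sub, smul_smul, smul_zero,
      sub_zero] <;>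
    match_scalars <;> field_simp <;> ring

end Quadratic

/-! ### Block triangular matrices and the coordinates -/

/-- The block triangular matrix `(T, v; 0, a)`. A map `f ↦ (M f, ∇ f; 0, f)` into these matrices is
multiplicative if and only if `M` is and `∇` satisfies the Leibniz rule twisted by `M`. -/
def block {A : Type*} [Ring A] (T : Matrix Idx Idx A) (v : Idx → A) (a : A) :
    Matrix (Idx ⊕ Unit) (Idx ⊕ Unit) A :=
  Matrix.fromBlocks T (Matrix.replicateCol Unit v) 0 (Matrix.diagonal fun _ => a)

section Block

variable {A : Type*} [Ring A]

theorem block_mul (T T' : Matrix Idx Idx A) (v v' : Idx → A) (a a' : A) :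
    block T v a * block T' v' a' = block (T * T') (fun μ => v μ * a' + (T *ᵥ v') μ) (a * a') := by
  simp only [block, Matrix.fromBlocks_multiply, Matrix.mul_zero, Matrix.zero_mul, add_zero,
    zero_add, Matrix.diagonal_mul_diagonal]
  congr 1
  ext μ ν
  simp [Matrix.mul_apply, Matrix.mulVec, dotProduct, add_comm]

theorem block_add (T T' : Matrix Idx Idx A) (v v' : Idx → A) (a a' : A) :
    block T v a + block T' v' a' = block (T + T') (v + v') (a + a') := by
  simp only [block, Matrix.fromBlocks_add, add_zero, Matrix.diagonal_add]
  rfl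

theorem block_sub (T T' : Matrix Idx Idx A) (v v' : Idx → A) (a a' : A) :
    block T v a - block T' v' a' = block (T - T') (v - v') (a - a') := by
  ext i j
  rcases i with i | i <;> rcases j with j | j <;> simp [block]

theorem block_one : block (1 : Matrix Idx Idx A) 0 1 = 1 := by
  ext i j
  rcases i with i | i <;> rcases j with j | j <;> simp [block, Matrix.one_apply]

theorem block_inj {T T' : Matrix Idx Idx A} {v v' : Idx → A} {a a' : A} :
    block T v a = block T' v' a' ↔ T = T' ∧ v = v' ∧ a = a' := by
  simp only [block, Matrix.fromBlocks_inj, Matrix.replicateCol_inj, true_and]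
  refine and_congr_right fun _ => and_congr_right fun _ => ⟨fun h => ?_, fun h => h ▸ rfl⟩
  simpa using congrFun (congrFun h ()) ()

variable [Algebra ℂ A] {q : ℂ} {x : Idx → A}

theorem block_smul (c : ℂ) (T : Matrix Idx Idx A) (v : Idx → A) (a : A) :
    c • block T v a = block (c • T) (c • v) (c • a) := by
  ext i j
  rcases i with i | i <;> rcases j with j | j <;> simp [block]

/-- The block matrix `(q L_{x_α}, e_α; 0, x_α)` that a calculus assigns to the coordinate `x_α`. -/
def coordBlock (q : ℂ) (x : Idx → A) (α : Idx) : Matrix (Idx ⊕ Unit) (Idx ⊕ Unit) A :=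
  block (q • vecL q x α) (Pi.single α 1) (x α)

theorem coordBlock_mul (α β : Idx) :
    coordBlock q x α * coordBlock q x β = block (q • vecL q x α * q • vecL q x β)
      (fun μ => (if μ = α then x β else 0) + q • vecL q x α μ β) (x α * x β) := by
  rw [coordBlock, coordBlock, block_mul]
  congr 1
  ext μ
  simp [Pi.single_apply]

theorem isMinkFamily_coordBlock (h : IsMinkFamily q x) (hq : q ≠ 0) (hq2 : q ^ 2 + 1 ≠ 0) :
    IsMinkFamily q (coordBlock q x) := by
  have h' : IsMinkFamily q (fun α => q • vecL q x α) := isMinkFamily_smul (isMinkFamily_vecL h hq)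
  constructor <;>
    simp only [coordBlock_mul, block_smul, block_sub, block_add, block_inj] <;>
    refine ⟨?_, ?_, ?_⟩
  · exact h'.minus_zero
  rotate_left 1
  · exact h.minus_zero
  · exact h'.plus_zero
  rotate_left 1
  · exact h.plus_zero
  · exact h'.three_zero
  rotate_left 1
  · exact h.three_zero
  · exact h'.minus_three
  rotate_left 1
  · exact h.minus_three
  · exact h'.three_plus
  rotate_left 1
  · exact h.three_plus
  · exact h'.minus_plus
  rotate_left 1
  · exact h.minus_plus
  -- The remaining equations, between the last columns, are linear in the coordinates.
  all_goals
    ext μ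
    simp only [Pi.sub_apply, Pi.smul_apply, Pi.add_apply, vecL, Matrix.smul_apply]
    cases μ <;> dsimp only [fourVecL] <;>
    simp only [reduceCtorEq, if_true, if_false] <;>
    match_scalars <;> field_simp <;> ring

theorem rootSq_coordBlock (hq : q ≠ 0) (hq1 : q ^ 2 - 1 ≠ 0) (hq2 : q ^ 2 + 1 ≠ 0) :
    rootSq q (coordBlock q x) = block (rootSq q fun α => q • vecL q x α)
      (fun μ => ((q ^ 2 + 3) / 2) • rootMat q x μ .zero +
        ((q ^ 2 - 1) / 2) • (if μ = .zero then x .zero else 0)) (rootSq q x) := by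
  rw [rootSq]
  simp only [coordBlock_mul, block_smul, block_sub, block_add, block_inj]
  refine ⟨rfl, ?_, rfl⟩
  ext μ
  simp only [Pi.sub_apply, Pi.smul_apply, Pi.add_apply, rootMat, vecL, Matrix.smul_apply,
    Matrix.sub_apply, Matrix.diagonal_apply]
  cases μ <;> dsimp only [fourVecL] <;>
    simp only [reduceCtorEq, if_true, if_false] <;>
    match_scalars <;> field_simp <;> ring

end Block

/-! ### The matrix of the root -/

theorem scalar_mul_mulVec {A : Type*} [Ring A] (a : A) (T : Matrix Idx Idx A) (v : Idx → A) :
    (Matrix.scalar Idx a * T) *ᵥ v = a • (T *ᵥ v) := by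
  ext μ
  simp [Matrix.mulVec, dotProduct, Finset.mul_sum, mul_assoc]

theorem scalar_mulVec {A : Type*} [Ring A] (a : A) (v : Idx → A) :
    Matrix.scalar Idx a *ᵥ v = a • v := by
  ext μ
  simp

theorem scalar_smul {A : Type*} [Ring A] [Algebra ℂ A] (c : ℂ) (a : A) :
    Matrix.scalar Idx (c • a) = c • Matrix.scalar Idx a :=
  map_smul (Matrix.scalarAlgHom (α := A) Idx ℂ) c a

theorem mulVec_smul_of_central {A : Type*} [Ring A] {c : A} (hc : ∀ a, Commute c a)
    (T : Matrix Idx Idx A) (v : Idx → A) : T *ᵥ (c • v) = c • (T *ᵥ v) := by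
  ext μ
  simp only [Matrix.mulVec, dotProduct, Pi.smul_apply, smul_eq_mul, Finset.mul_sum]
  exact Finset.sum_congr rfl fun ν _ => by rw [← mul_assoc, ← (hc _).eq, mul_assoc]

theorem pow_mulVec_of_eigen {A : Type*} [Ring A] {c : A} (hc : ∀ a, Commute c a)
    {T : Matrix Idx Idx A} {v : Idx → A} (h : T *ᵥ v = c • v) (k : ℕ) :
    T ^ k *ᵥ v = c ^ k • v := by
  induction k with
  | zero => simp
  | succ k ih =>
    rw [pow_succ', ← Matrix.mulVec_mulVec, ih,
      mulVec_smul_of_central fun a => (hc a).pow_left k, h, smul_smul, ← pow_succ]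

section RootBlock

variable {A : Type*} [Ring A] [Algebra ℂ A] {q : ℂ} {x : Idx → A} {r ri : A}

/-- A family `x` that satisfies the relations of quantum Minkowski space, together with an
invertible central root `r` of `x₀² - 4 x² / [2]²` and its inverse `ri`. -/
structure IsRoot {A : Type*} [Ring A] [Algebra ℂ A] (q : ℂ) (x : Idx → A) (r ri : A) : Prop where
  family : IsMinkFamily q x
  zero_comm : ∀ a, Commute (x .zero) a
  comm : ∀ a, Commute r a
  inv_comm : ∀ a, Commute ri a
  mul_inv : r * ri = 1
  mul_self : r * r = rootSq q x

/-- The matrix `(L_{x₀} - b) / √(b² - c)`. -/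
def signOf (q : ℂ) (x : Idx → A) (ri : A) : Matrix Idx Idx A :=
  Matrix.scalar Idx ri * rootMat q x

/-- The matrix `(q / 2) ([2] r + λ x₀ S)` prescribed for the root `r`, where `S` is the sign matrix.
-/
def twistRoot (q : ℂ) (x : Idx → A) (r ri : A) : Matrix Idx Idx A :=
  (q / 2) • ((q + q⁻¹) • Matrix.scalar Idx r +
    (q - q⁻¹) • (Matrix.scalar Idx (x .zero) * signOf q x ri))

/-- `L_{x₀} = [2] x₀ / 2 + (λ / 2) r S`. -/
theorem vecL_zero (hq : q ≠ 0) (hq1 : q ^ 2 - 1 ≠ 0) :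
    vecL q x .zero = ((q + q⁻¹) / 2) • Matrix.scalar Idx (x .zero) +
      ((q - q⁻¹) / 2) • rootMat q x := by
  have hl : q - q⁻¹ ≠ 0 := by
    intro hl
    apply hq1
    field_simp at hl
    simpa using hl
  rw [rootMat, smul_smul, div_mul_div_cancel₀ two_ne_zero, div_self hl, one_smul]
  exact (add_sub_cancel _ _).symm

theorem signOf_mul_signOf (h : IsRoot q x r ri) (hq : q ≠ 0) (hq1 : q ^ 2 - 1 ≠ 0)
    (hq2 : q ^ 2 + 1 ≠ 0) : signOf q x ri * signOf q x ri = 1 := by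
  have h1 : rootMat q x * rootMat q x = Matrix.scalar Idx (r * r) := by
    rw [rootMat_mul_rootMat h.family hq hq1 hq2, h.mul_self]
    rfl
  have h2 : r * r * ri * ri = 1 := by
    rw [mul_assoc r r ri, h.mul_inv, mul_one, h.mul_inv]
  rw [signOf, ← mul_assoc, mul_assoc _ _ (Matrix.scalar Idx ri),
    ← (Matrix.scalar_commute ri h.inv_comm _).eq, ← mul_assoc, mul_assoc, h1, ← map_mul, ← map_mul,
    ← ((h.comm (ri * ri)).mul_left (h.comm (ri * ri))).eq, ← mul_assoc, h2, map_one]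

theorem scalar_mul_signOf (h : IsRoot q x r ri) :
    Matrix.scalar Idx r * signOf q x ri = rootMat q x := by
  rw [signOf, ← mul_assoc, ← map_mul, h.mul_inv, map_one, one_mul]

theorem commute_rootMat_vecL (h : IsRoot q x r ri) (hq : q ≠ 0) (α : Idx) :
    Commute (rootMat q x) (vecL q x α) := by
  have h1 := isMinkFamily_vecL h.family hq
  have h2 : Commute (vecL q x .zero) (vecL q x α) := by
    cases α
    · exact Commute.refl _
    · exact h1.minus_zero.symm
    · exact h1.plus_zero.symm
    · exact h1.three_zero.symm
  exact (h2.sub_left ((Matrix.scalar_commute (x .zero) h.zero_comm _).smul_left _)).smul_left _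

theorem commute_twistRoot_vecL (h : IsRoot q x r ri) (hq : q ≠ 0) (α : Idx) :
    Commute (twistRoot q x r ri) (vecL q x α) := by
  have h1 : Commute (signOf q x ri) (vecL q x α) :=
    (Matrix.scalar_commute ri h.inv_comm _).mul_left (commute_rootMat_vecL h hq α)
  exact (((Matrix.scalar_commute r h.comm _).smul_left _).add_left
    (((Matrix.scalar_commute (x .zero) h.zero_comm _).mul_left h1).smul_left _)).smul_left _

theorem scalar_mul_twistRoot (h : IsRoot q x r ri) :
    Matrix.scalar Idx r * twistRoot q x r ri = (q / 2) • ((q + q⁻¹) •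
      Matrix.scalar Idx (rootSq q x) +
        (q - q⁻¹) • (Matrix.scalar Idx (x .zero) * rootMat q x)) := by
  rw [twistRoot, mul_smul_comm, mul_add, mul_smul_comm, mul_smul_comm, ← map_mul, h.mul_self,
    ← mul_assoc, (Matrix.scalar_commute r h.comm _).eq, mul_assoc, scalar_mul_signOf h]

theorem twistRoot_mul_twistRoot (h : IsRoot q x r ri) (hq : q ≠ 0) (hq1 : q ^ 2 - 1 ≠ 0)
    (hq2 : q ^ 2 + 1 ≠ 0) :
    twistRoot q x r ri * twistRoot q x r ri = rootSq q (fun α => q • vecL q x α) := by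
  have h1 : rootSq q (fun α => q • vecL q x α) = q ^ 2 • rootSq q (vecL q x) := by
    simp only [rootSq, smul_mul_smul_comm]
    module
  have h0 := Matrix.scalar_commute (n := Idx) (x .zero) h.zero_comm (signOf q x ri)
  have h2 := signOf_mul_signOf h hq hq1 hq2
  have h3 := scalar_mul_signOf h
  have h4 := Matrix.scalar_commute (n := Idx) r h.comm
  rw [h1, rootSq_vecL h.family hq hq1 hq2]
  have h5 : (Matrix.scalar Idx (x .zero) * signOf q x ri) *
      (Matrix.scalar Idx (x .zero) * signOf q x ri) = Matrix.scalar Idx (x .zero * x .zero) := by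
    rw [← mul_assoc, mul_assoc _ (signOf q x ri), ← h0.eq, ← mul_assoc, mul_assoc, h2, mul_one,
      map_mul]
  have h6 : Matrix.scalar Idx r * (Matrix.scalar Idx (x .zero) * signOf q x ri) =
      Matrix.scalar Idx (x .zero) * rootMat q x := by
    rw [← mul_assoc, (h4 _).eq, mul_assoc, h3]
  have h7 : (Matrix.scalar Idx (x .zero) * signOf q x ri) * Matrix.scalar Idx r =
      Matrix.scalar Idx (x .zero) * rootMat q x := by
    rw [← (h4 _).eq, h6]
  have h8 : Matrix.scalar Idx r * Matrix.scalar Idx r = Matrix.scalar Idx (rootSq q x) := by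
    rw [← map_mul, h.mul_self]
  have h9 : x .zero • rootMat q x = Matrix.scalar Idx (x .zero) * rootMat q x :=
    Matrix.smul_eq_diagonal_mul (rootMat q x) (x .zero)
  have h10 : (Matrix.diagonal fun _ : Idx => (4⁻¹ : ℂ) • ((q + q⁻¹) ^ 2 • rootSq q x +
      (q - q⁻¹) ^ 2 • (x .zero * x .zero))) = (4⁻¹ : ℂ) • ((q + q⁻¹) ^ 2 •
        Matrix.scalar Idx (rootSq q x) +
          (q - q⁻¹) ^ 2 • Matrix.scalar Idx (x .zero * x .zero)) := by
    ext μ ν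
    by_cases hμ : μ = ν <;> simp [hμ]
  rw [h9, h10, twistRoot]
  simp only [smul_mul_smul_comm, add_mul, mul_add, h5, h6, h7, h8]
  module

/-- The block matrix `(M r, S e₀; 0, r)` that a calculus assigns to the root `r`. Its last column,
where `S` is the sign matrix, is the gradient of the root. -/
def rootBlock (q : ℂ) (x : Idx → A) (r ri : A) : Matrix (Idx ⊕ Unit) (Idx ⊕ Unit) A :=
  block (twistRoot q x r ri) (fun μ => signOf q x ri μ .zero) r

/-- The root is left cancellable. -/
theorem IsRoot.cancel (h : IsRoot q x r ri) {a b : A} (hab : r * a = r * b) : a = b := by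
  have h1 : ri * r = 1 := by rw [(h.inv_comm r).eq, h.mul_inv]
  rw [← one_mul a, ← one_mul b, ← h1, mul_assoc, mul_assoc, hab]

theorem commute_rootBlock (h : IsRoot q x r ri) (hq : q ≠ 0) (hq1 : q ^ 2 - 1 ≠ 0)
    (hq2 : q ^ 2 + 1 ≠ 0) (α : Idx) : Commute (rootBlock q x r ri) (coordBlock q x α) := by
  rw [Commute, SemiconjBy, rootBlock, coordBlock, block_mul, block_mul, block_inj]
  refine ⟨((commute_twistRoot_vecL h hq α).smul_right q).eq, ?_, (h.comm _).eq⟩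
  ext μ
  -- Multiplication by `r` removes its inverse from the sign matrix.
  apply h.cancel
  have hS : ∀ ν, r * signOf q x ri ν .zero = rootMat q x ν .zero := fun ν => by
    have := congrFun (congrFun (scalar_mul_signOf h) ν) Idx.zero
    simpa using this
  have hT : r * twistRoot q x r ri μ α = (q / 2) • ((q + q⁻¹) •
      (Matrix.diagonal fun _ => rootSq q x) μ α + (q - q⁻¹) • (x .zero * rootMat q x μ α)) := by
    have := congrFun (congrFun (scalar_mul_twistRoot h) μ) α
    simpa using this
  have h1 := rootMat_col_comm h.family hq hq1 hq2 μ α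
  have h2 : r * ((q • vecL q x α) *ᵥ fun ν => signOf q x ri ν .zero) μ =
      ∑ ν, (q • vecL q x α) μ ν * rootMat q x ν .zero := by
    simp only [Matrix.mulVec, dotProduct, Finset.mul_sum]
    refine Finset.sum_congr rfl fun ν _ => ?_
    rw [← mul_assoc, (h.comm _).eq, mul_assoc, hS]
  have h3 : r * ((Pi.single α 1 : Idx → A) μ * r) = (Matrix.diagonal fun _ => rootSq q x) μ α := by
    rw [Matrix.diagonal_apply, Pi.single_apply]
    split_ifs
    · rw [one_mul, h.mul_self]
    · simp
  rw [mul_add, mul_add, ← mul_assoc, hS, h2, h3, Matrix.mulVec_single_one]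
  rw [← h1, ← hT]
  rfl

theorem rootBlock_mul_rootBlock (h : IsRoot q x r ri) (hq : q ≠ 0) (hq1 : q ^ 2 - 1 ≠ 0)
    (hq2 : q ^ 2 + 1 ≠ 0) :
    rootBlock q x r ri * rootBlock q x r ri = rootSq q (coordBlock q x) := by
  rw [rootSq_coordBlock hq hq1 hq2, rootBlock, block_mul, block_inj]
  refine ⟨twistRoot_mul_twistRoot h hq hq1 hq2, ?_, h.mul_self⟩
  have h1 : twistRoot q x r ri * signOf q x ri = (q / 2) • ((q + q⁻¹) • rootMat q x +
      (q - q⁻¹) • Matrix.scalar Idx (x .zero)) := by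
    rw [twistRoot, smul_mul_assoc, add_mul, smul_mul_assoc, smul_mul_assoc, scalar_mul_signOf h,
      mul_assoc, signOf_mul_signOf h hq hq1 hq2, mul_one]
  ext μ
  have h2 : (twistRoot q x r ri *ᵥ fun ν => signOf q x ri ν .zero) μ = 
      (q / 2) • ((q + q⁻¹) • rootMat q x μ .zero +
      (q - q⁻¹) • (if μ = .zero then x .zero else 0)) := by
    have := congrFun (congrFun h1 μ) Idx.zero
    rw [Matrix.mul_apply] at this
    simpa [Matrix.diagonal_apply, Matrix.mulVec, dotProduct] using this
  have h3 : signOf q x ri μ .zero * r = rootMat q x μ .zero := by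
    rw [← (h.comm _).eq]
    simpa using congrFun (congrFun (scalar_mul_signOf h) μ) Idx.zero
  rw [h2, h3]
  match_scalars <;> field_simp
  ring

/-- The gradient of the root is determined by the prescribed data, although it is not prescribed
itself: the root commutes with `x₀`, and its square is a polynomial in the coordinates. For the
difference `d` of two solutions these facts say `r S d = -x₀ d` and `M d + r d = 0`, where `M` is
the matrix of the root. With `S² = 1` the first equation turns the second one into `2 r d = 0`. -/
theorem eq_signOf_of_block (h : IsRoot q x r ri) (hq : q ≠ 0) (hq1 : q ^ 2 - 1 ≠ 0)
    (hq2 : q ^ 2 + 1 ≠ 0) {v : Idx → A}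
    (hc : Commute (block (twistRoot q x r ri) v r) (coordBlock q x .zero))
    (hs : block (twistRoot q x r ri) v r * block (twistRoot q x r ri) v r =
      rootSq q (coordBlock q x)) : v = fun μ => signOf q x ri μ .zero := by
  set u : Idx → A := fun μ => signOf q x ri μ .zero with hu
  have hc' : Commute (block (twistRoot q x r ri) u r) (coordBlock q x .zero) :=
    commute_rootBlock h hq hq1 hq2 .zero
  have hs' : block (twistRoot q x r ri) u r * block (twistRoot q x r ri) u r =
      rootSq q (coordBlock q x) := rootBlock_mul_rootBlock h hq hq1 hq2
  rw [Commute, SemiconjBy, coordBlock, block_mul, block_mul, block_inj] at hc hc'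
  rw [← hs', block_mul, block_mul, block_inj] at hs
  obtain ⟨-, hc, -⟩ := hc
  obtain ⟨-, hc', -⟩ := hc'
  obtain ⟨-, hs, -⟩ := hs
  rw [← sub_eq_zero]
  obtain ⟨d, hd⟩ : ∃ d, d = v - u := ⟨_, rfl⟩
  rw [← hd]
  have hv : v = d + u := by rw [hd, sub_add_cancel]
  -- The difference `d` satisfies the homogeneous equations.
  have e1 : x .zero • d = q • (vecL q x .zero *ᵥ d) := by
    ext μ
    have a1 := congrFun hc μ
    have a2 := congrFun hc' μ
    simp only [hv, Pi.add_apply, Matrix.mulVec_add, add_mul, Matrix.smul_mulVec,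
      Pi.smul_apply] at a1 a2 ⊢
    rw [smul_eq_mul, (h.zero_comm _).eq]
    have a3 := congrArg₂ (· - ·) a1 a2
    rw [← sub_eq_zero] at a3 ⊢
    rw [← a3]
    abel
  have e2 : twistRoot q x r ri *ᵥ d + r • d = 0 := by
    ext μ
    have a1 := congrFun hs μ
    simp only [hv, Pi.add_apply, Matrix.mulVec_add, add_mul] at a1
    rw [Pi.add_apply, Pi.smul_apply, smul_eq_mul, (h.comm _).eq, Pi.zero_apply]
    rw [← sub_eq_zero] at a1
    rw [← a1]
    abel
  have e4 : rootMat q x *ᵥ d = -(x .zero • d) := by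
    rw [vecL_zero hq hq1, Matrix.add_mulVec, Matrix.smul_mulVec, Matrix.smul_mulVec,
      scalar_mulVec] at e1
    have e5 : ((q ^ 2 - 1) / 2) • (rootMat q x *ᵥ d + x .zero • d) = 0 := by
      generalize rootMat q x *ᵥ d = a at e1
      generalize x .zero • d = b at e1
      rw [← sub_eq_zero.2 e1.symm]
      match_scalars <;> field_simp
      ring
    rcases smul_eq_zero.1 e5 with e6 | e6
    · exact absurd e6 (div_ne_zero hq1 two_ne_zero)
    · exact eq_neg_of_add_eq_zero_left e6
  have e5 : signOf q x ri *ᵥ d = -(ri • x .zero • d) := by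
    rw [signOf, scalar_mul_mulVec, e4, smul_neg]
  have e6 : x .zero • (signOf q x ri *ᵥ d) = -(r • d) := by
    have a1 : signOf q x ri *ᵥ (signOf q x ri *ᵥ d) = d := by
      rw [Matrix.mulVec_mulVec, signOf_mul_signOf h hq hq1 hq2, Matrix.one_mulVec]
    have a2 : signOf q x ri *ᵥ (ri • x .zero • d) = (ri * x .zero) • (signOf q x ri *ᵥ d) := by
      rw [smul_smul]
      have a3 : ∀ a, Commute (ri * x .zero) a := fun a => (h.inv_comm a).mul_left (h.zero_comm a)
      rw [← scalar_mulVec, Matrix.mulVec_mulVec, ← (Matrix.scalar_commute _ a3 _).eq,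
        scalar_mul_mulVec]
    rw [e5, Matrix.mulVec_neg, a2] at a1
    rw [← a1, smul_neg, neg_neg, smul_smul, ← mul_assoc, h.mul_inv, one_mul, a1]
  have e7 : (2 : ℂ) • (r • d) = 0 := by
    rw [twistRoot, Matrix.smul_mulVec, Matrix.add_mulVec, Matrix.smul_mulVec, Matrix.smul_mulVec,
      scalar_mulVec, scalar_mul_mulVec, e6] at e2
    generalize r • d = a at e2
    rw [← e2]
    match_scalars
    field_simp
    ring
  have e8 : r • d = 0 := (smul_eq_zero.1 e7).resolve_left two_ne_zero
  ext μ
  apply h.cancel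
  rw [Pi.zero_apply, mul_zero]
  exact congrFun e8 μ

end RootBlock

/-! ### Generators and universal property of the extended algebra -/

theorem IsMinkFamily.map {A B : Type*} [Ring A] [Algebra ℂ A] [Ring B] [Algebra ℂ B] {q : ℂ}
    {x : Idx → A} (h : IsMinkFamily q x) (φ : A →ₐ[ℂ] B) : IsMinkFamily q (fun α => φ (x α)) := by
  constructor <;> simp only [← map_mul, ← map_sub, ← map_add, ← map_smul, h.minus_zero,
    h.plus_zero, h.three_zero, h.minus_three, h.three_plus, h.minus_plus]

theorem rootSq_map {A B : Type*} [Ring A] [Algebra ℂ A] [Ring B] [Algebra ℂ B] (q : ℂ)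
    (x : Idx → A) (φ : A →ₐ[ℂ] B) : rootSq q (fun α => φ (x α)) = φ (rootSq q x) := by
  simp only [rootSq, map_mul, map_sub, map_add, map_smul]

variable {q : ℝ}

/-- The normal-ordered relations are equivalent to the defining ones. -/
theorem isMinkFamily_iff {A : Type*} [Ring A] [Algebra ℂ A] (h0 : 0 < q) (B : Idx → A) :
    IsMinkFamily (q : ℂ) B ↔ ∀ ⦃a b⦄, MinkRel q a b →
      FreeAlgebra.lift ℂ B a = FreeAlgebra.lift ℂ B b := by
  have hq : (q : ℂ) ≠ 0 := by exact_mod_cast h0.ne'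
  constructor
  · intro h a b hab
    cases hab <;> simp only [map_mul, map_sub, map_smul, map_neg, FreeAlgebra.lift_ι_apply,
      h.minus_zero, h.plus_zero, h.three_zero, h.minus_three, h.three_plus, h.minus_plus,
      lam_ofReal, Complex.ofReal_inv] <;> match_scalars <;> field_simp <;> ring
  · intro h
    have h1 := h MinkRel.minus_zero
    have h2 := h MinkRel.plus_zero
    have h3 := h MinkRel.three_zero
    have h4 := h MinkRel.minus_three
    have h5 := h MinkRel.three_plus
    have h6 := h MinkRel.minus_plus
    simp only [map_mul, map_sub, map_smul, map_neg, FreeAlgebra.lift_ι_apply,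
      lam_ofReal, Complex.ofReal_inv] at h1 h2 h3 h4 h5 h6
    refine ⟨h1, h2, h3, ?_, ?_, ?_⟩
    · rw [h1] at h4
      rw [← sub_eq_zero] at h4 ⊢
      rw [← smul_zero (q : ℂ), ← h4]
      match_scalars <;> field_simp
    · rw [h2] at h5
      rw [← sub_eq_zero] at h5 ⊢
      rw [← smul_zero (q : ℂ), ← h5]
      match_scalars <;> field_simp
    · rw [h3] at h6
      rw [← sub_eq_zero] at h6 ⊢
      rw [← h6]
      match_scalars <;> field_simp

theorem isMinkFamily_coord (h0 : 0 < q) : IsMinkFamily (q : ℂ) (coord q) := by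
  rw [isMinkFamily_iff h0]
  have h : FreeAlgebra.lift ℂ (coord q) = mkMink q := by
    ext
    simp [coord]
  rw [h]
  exact fun a b hab => RingQuot.mkAlgHom_rel ℂ hab

theorem Mink.mem_of_generators (S : Subalgebra ℂ (Mink q)) (h : ∀ α, coord q α ∈ S) (f : Mink q) :
    f ∈ S := by
  obtain ⟨p, rfl⟩ : ∃ p, mkMink q p = f := RingQuot.mkAlgHom_surjective ℂ (MinkRel q) f
  induction p using FreeAlgebra.induction with
  | grade0 c => rw [AlgHom.commutes]; exact S.algebraMap_mem c
  | grade1 α => exact h α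
  | mul a b ha hb => rw [map_mul]; exact S.mul_mem ha hb
  | add a b ha hb => rw [map_add]; exact S.add_mem ha hb

theorem qSym_two_ne_zero (h0 : 0 < q) (h1 : q ≠ 1) : (qSym q 2 : ℂ) ≠ 0 := by
  have : 0 < qSym q 2 := by rw [qSym_two h0 h1]; positivity
  exact_mod_cast this.ne'

theorem alpha_eq (h0 : 0 < q) (h1 : q ≠ 1) : alpha q = (qSym q 2 : ℂ) • root q := by
  rw [root, smul_smul, mul_inv_cancel₀ (qSym_two_ne_zero h0 h1), one_smul]

theorem MinkSqrt.mem_of_generators (h0 : 0 < q) (h1 : q ≠ 1) (S : Subalgebra ℂ (MinkSqrt q))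
    (h : ∀ α, x q α ∈ S) (hr : root q ∈ S) (f : MinkSqrt q) : f ∈ S := by
  obtain ⟨p, rfl⟩ : ∃ p, mkSqrt q p = f := RingQuot.mkAlgHom_surjective ℂ (SqrtRel q) f
  have hC : ∀ a, mkSqrt q (Polynomial.C a) ∈ S :=
    fun a => Mink.mem_of_generators (S.comap (toSqrt q)) h a
  have hX : mkSqrt q Polynomial.X ∈ S := by
    have := S.smul_mem hr (qSym q 2 : ℂ)
    rwa [← alpha_eq h0 h1] at this
  induction p using Polynomial.induction_on' with
  | add a b ha hb => rw [map_add]; exact S.add_mem ha hb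
  | monomial n a =>
    rw [← Polynomial.C_mul_X_pow_eq_monomial, map_mul, map_pow]
    exact S.mul_mem (hC a) (S.pow_mem hX n)

theorem MinkLoc.mem_of_generators (S : Subalgebra ℂ (MinkLoc q))
    (h : ∀ f, toLoc q f ∈ S) (hi : alphaInv q ∈ S) (f : MinkLoc q) : f ∈ S := by
  obtain ⟨p, rfl⟩ : ∃ p, mkLoc q p = f := RingQuot.mkAlgHom_surjective ℂ (LocRel q) f
  induction p using Polynomial.induction_on' with
  | add a b ha hb => rw [map_add]; exact S.add_mem ha hb
  | monomial n a =>
    rw [← Polynomial.C_mul_X_pow_eq_monomial, map_mul, map_pow]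
    exact S.mul_mem (h a) (S.pow_mem hi n)

theorem commute_alphaInv (f : MinkLoc q) : Commute (alphaInv q) f := by
  obtain ⟨p, rfl⟩ : ∃ p, mkLoc q p = f := RingQuot.mkAlgHom_surjective ℂ (LocRel q) f
  exact (Polynomial.commute_X p).map (mkLoc q)

theorem commute_root (f : MinkSqrt q) : Commute (root q) f := by
  obtain ⟨p, rfl⟩ : ∃ p, mkSqrt q p = f := RingQuot.mkAlgHom_surjective ℂ (SqrtRel q) f
  exact ((Polynomial.commute_X p).map (mkSqrt q)).smul_left _

theorem commute_x_zero (h0 : 0 < q) (h1 : q ≠ 1) (f : MinkSqrt q) : Commute (x q .zero) f := by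
  have h := MinkSqrt.mem_of_generators h0 h1 (Subalgebra.centralizer ℂ {x q .zero}) ?_ ?_ f
  · exact (Subalgebra.mem_centralizer_iff ℂ).1 h _ rfl
  · intro α
    have hx : IsMinkFamily (q : ℂ) (fun α => toSqrt q (coord q α)) :=
      (isMinkFamily_coord h0).map (toSqrt q)
    rw [Subalgebra.mem_centralizer_iff]
    rintro _ rfl
    cases α
    · rfl
    · exact hx.minus_zero.symm
    · exact hx.plus_zero.symm
    · exact hx.three_zero.symm
  · rw [Subalgebra.mem_centralizer_iff]
    rintro _ rfl
    exact (commute_root _).eq.symm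

theorem commute_toLoc {c : MinkSqrt q} (hc : ∀ f, Commute c f) (f : MinkLoc q) :
    Commute (toLoc q c) f := by
  have h := MinkLoc.mem_of_generators (Subalgebra.centralizer ℂ {toLoc q c}) ?_ ?_ f
  · exact (Subalgebra.mem_centralizer_iff ℂ).1 h _ rfl
  · intro g
    rw [Subalgebra.mem_centralizer_iff]
    rintro _ rfl
    exact ((hc g).map (toLoc q)).eq
  · rw [Subalgebra.mem_centralizer_iff]
    rintro _ rfl
    exact (commute_alphaInv _).eq.symm

theorem root_mul_root (h0 : 0 < q) (h1 : q ≠ 1) : root q * root q = rootSq (q : ℂ) (x q) := by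
  have h2 : qSym q 2 ≠ 0 := by exact_mod_cast qSym_two_ne_zero h0 h1
  rw [← pow_two, root_sq q h2, rootSq, qSym_two h0 h1, fourSq]
  simp only [map_add, map_sub, map_smul, map_mul, pow_two, Complex.ofReal_add, Complex.ofReal_inv]
  rfl

/-- The coordinates `x_α` in the localization. -/
def locCoord (q : ℝ) (α : Idx) : MinkLoc q := toLoc q (x q α)

theorem isRoot_locCoord (h0 : 0 < q) (h1 : q ≠ 1) :
    IsRoot (q : ℂ) (locCoord q) (toLoc q (root q)) (rootInv q) where
  family := (isMinkFamily_coord h0).map ((toLoc q).comp (toSqrt q))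
  zero_comm := commute_toLoc (commute_x_zero h0 h1)
  comm := commute_toLoc commute_root
  inv_comm a := (commute_alphaInv a).smul_left _
  mul_inv := root_mul_rootInv q (by exact_mod_cast qSym_two_ne_zero h0 h1)
  mul_self := by
    rw [← map_mul, root_mul_root h0 h1]
    exact (rootSq_map (q : ℂ) (x q) (toLoc q)).symm

/-- The universal property of the extension of quantum Minkowski space by the root. -/
theorem exists_algHom {C : Type*} [Ring C] [Algebra ℂ C] (h0 : 0 < q) (h1 : q ≠ 1) {B : Idx → C}
    {s : C} (hB : IsMinkFamily (q : ℂ) B) (hs : ∀ α, Commute s (B α))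
    (hsq : s * s = rootSq (q : ℂ) B) :
    ∃ Φ : MinkSqrt q →ₐ[ℂ] C, (∀ α, Φ (x q α) = B α) ∧ Φ (root q) = s := by
  let φ₀ : FreeAlgebra ℂ Idx →ₐ[ℂ] C := FreeAlgebra.lift ℂ B
  let φ₁ : Mink q →ₐ[ℂ] C := RingQuot.liftAlgHom ℂ ⟨φ₀, (isMinkFamily_iff h0 B).1 hB⟩
  have e1 : ∀ α, φ₁ (coord q α) = B α := fun α => by
    refine (RingQuot.liftAlgHom_mkAlgHom_apply ℂ φ₀ _ _).trans ?_
    exact FreeAlgebra.lift_ι_apply B α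
  have hc : ∀ a, Commute (φ₁ a) ((qSym q 2 : ℂ) • s) := fun a => by
    have h := Mink.mem_of_generators ((Subalgebra.centralizer ℂ {s}).comap φ₁) (fun α => ?_) a
    · have h' : Commute (φ₁ a) s := ((Subalgebra.mem_centralizer_iff ℂ).1 h s rfl).symm
      exact h'.smul_right _
    · rw [Subalgebra.mem_comap, Subalgebra.mem_centralizer_iff, e1]
      rintro _ rfl
      exact hs α
  let φ₂ : Polynomial (Mink q) →ₐ[ℂ] C := Polynomial.eval₂AlgHom φ₁ ((qSym q 2 : ℂ) • s) hc
  have e2 : ∀ a, φ₂ (Polynomial.C a) = φ₁ a := fun a => Polynomial.eval₂_C _ _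
  have e3 : φ₂ Polynomial.X = (qSym q 2 : ℂ) • s := Polynomial.eval₂_X _ _
  have hq : (q : ℂ) ≠ 0 := by exact_mod_cast h0.ne'
  have hq2 : (q : ℂ) ^ 2 + 1 ≠ 0 := by
    have : q ^ 2 + 1 ≠ 0 := by positivity
    exact_mod_cast this
  have e4 : ∀ ⦃a b⦄, SqrtRel q a b → φ₂ a = φ₂ b := by
    rintro _ _ ⟨⟩
    rw [map_pow, e3, e2, smul_pow, pow_two s, hsq, qSym_two h0 h1]
    simp only [fourSq, map_add, map_sub, map_smul, map_mul, pow_two (coord q _), e1, rootSq,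
      Complex.ofReal_add, Complex.ofReal_inv]
    match_scalars <;> field_simp
  let φ₃ : MinkSqrt q →ₐ[ℂ] C := RingQuot.liftAlgHom ℂ ⟨φ₂, e4⟩
  have e5 : ∀ p, φ₃ (mkSqrt q p) = φ₂ p := fun p => RingQuot.liftAlgHom_mkAlgHom_apply ℂ φ₂ _ _
  refine ⟨φ₃, fun α => ?_, ?_⟩
  · exact (e5 _).trans ((e2 _).trans (e1 α))
  · rw [root, alpha, map_smul, e5, e3, smul_smul, inv_mul_cancel₀ (qSym_two_ne_zero h0 h1),
      one_smul]

/-! ### Existence and uniqueness of the calculus -/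

theorem ofReal_sq_add_one_ne_zero (h0 : 0 < q) : (q : ℂ) ^ 2 + 1 ≠ 0 := by
  have : q ^ 2 + 1 ≠ 0 := by positivity
  exact_mod_cast this

theorem ofReal_sq_sub_one_ne_zero (h0 : 0 < q) (h1 : q ≠ 1) : (q : ℂ) ^ 2 - 1 ≠ 0 := by
  have : q ^ 2 - 1 ≠ 0 := by
    intro h
    have h2 : (q - 1) * (q + 1) = 0 := by linear_combination h
    rcases mul_eq_zero.1 h2 with h3 | h3
    · exact h1 (by linarith)
    · linarith
  exact_mod_cast this

/-- `fourVecL` is linear in the family, hence determined by its values at unit vectors. -/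
theorem sum_fourVecL_single {A : Type*} [Ring A] [Algebra ℂ A] (p : ℂ) (y : Idx → A) (α μ ν : Idx) :
    ∑ β, fourVecL p (Pi.single β (1 : ℂ)) α μ ν • y β = fourVecL p y α μ ν := by
  rw [Idx.sum_univ]
  cases α <;> cases μ <;> cases ν <;> dsimp only [fourVecL] <;>
    simp only [Pi.single_apply, reduceCtorEq, if_true, if_false, smul_eq_mul, mul_one, mul_zero,
      add_zero, zero_add, zero_smul]

theorem Lcoord_eq (h0 : 0 < q) (h1 : q ≠ 1) (α : Idx) :
    Lcoord q α = vecL (q : ℂ) (locCoord q) α := by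
  ext μ ν
  rw [vecL, Matrix.smul_apply, ← sum_fourVecL_single, Finset.smul_sum]
  refine Finset.sum_congr rfl fun β _ => ?_
  rw [RII_eq_fourVecL h0 h1, smul_smul, div_eq_inv_mul]
  rfl

theorem signMat_eq (h0 : 0 < q) (h1 : q ≠ 1) :
    signMat q = signOf (q : ℂ) (locCoord q) (rootInv q) := by
  ext μ ν
  rw [signMat, signOf, rootMat, Lcoord_eq h0 h1, lam, qSym_two h0 h1, mul_smul_comm,
    Matrix.smul_apply, Matrix.scalar_apply, Matrix.diagonal_mul, Matrix.sub_apply,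
    Matrix.smul_apply, Matrix.diagonal_apply]
  push_cast
  by_cases h : μ = ν
  · simp [h, locCoord]
  · simp [h]

/-- The functional calculus prescription for the root, in terms of the sign matrix. -/
theorem twistRoot_eq (h0 : 0 < q) (h1 : q ≠ 1) :
    (q : ℂ) • (toLoc q (rootTauPlus q) • PiPlus q + toLoc q (rootTauMinus q) • PiMinus q) =
      twistRoot (q : ℂ) (locCoord q) (toLoc q (root q)) (rootInv q) := by
  rw [PiPlus, PiMinus, signMat_eq h0 h1, twistRoot]
  generalize signOf (q : ℂ) (locCoord q) (rootInv q) = S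
  ext μ ν
  simp only [rootTauPlus, rootTauMinus, map_smul, map_add, map_neg, Matrix.smul_apply,
    Matrix.add_apply, Matrix.sub_apply, smul_eq_mul, Matrix.scalar_apply, Matrix.diagonal_mul,
    Matrix.one_apply, Matrix.diagonal_apply, locCoord, lam_ofReal, qSym_two h0 h1,
    Complex.ofReal_add, Complex.ofReal_inv]
  generalize S μ ν = s
  generalize toLoc q (x q .zero) = y
  generalize toLoc q (root q) = r
  split_ifs <;>
    simp only [mul_add, mul_sub, add_mul, neg_mul, mul_neg, smul_mul_assoc, mul_smul_comm, mul_one,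
      smul_add, smul_sub, smul_neg, smul_smul, smul_zero, zero_sub, zero_add] <;>
    module

/-- The algebra homomorphism `f ↦ (M f, ∇ f; 0, f)` that encodes a calculus. -/
def Calculus.toBlock (D : Calculus q) :
    MinkSqrt q →ₐ[ℂ] Matrix (Idx ⊕ Unit) (Idx ⊕ Unit) (MinkLoc q) :=
  AlgHom.ofLinearMap
    { toFun := fun f => block (D.twist f) (D.grad f) (toLoc q f)
      map_add' := fun f g => by simp only [map_add, block_add]
      map_smul' := fun c f => by simp only [map_smul, block_smul, RingHom.id_apply] }
    (by
      have h : D.grad 1 = 0 := by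
        ext μ
        have := D.grad_mul 1 1 μ
        simpa [Matrix.one_apply] using this
      simp only [LinearMap.coe_mk, AddHom.coe_mk, map_one, h, block_one])
    (fun f g => by
      simp only [LinearMap.coe_mk, AddHom.coe_mk, map_mul, block_mul]
      congr 1
      ext μ
      exact D.grad_mul f g μ)

theorem Calculus.toBlock_apply (D : Calculus q) (f : MinkSqrt q) :
    D.toBlock f = block (D.twist f) (D.grad f) (toLoc q f) := rfl

theorem Calculus.toBlock_x (D : Calculus q) (h0 : 0 < q) (h1 : q ≠ 1) (α : Idx) :
    D.toBlock (x q α) = coordBlock (q : ℂ) (locCoord q) α := by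
  rw [D.toBlock_apply, D.twist_coord, D.grad_coord, Lcoord_eq h0 h1]
  rfl

theorem Calculus.grad_root (D : Calculus q) (h0 : 0 < q) (h1 : q ≠ 1) :
    D.grad (root q) = fun μ => signMat q μ .zero := by
  have hr : D.toBlock (root q) =
      block (twistRoot (q : ℂ) (locCoord q) (toLoc q (root q)) (rootInv q)) (D.grad (root q))
        (toLoc q (root q)) := by
    rw [D.toBlock_apply, D.twist_root, twistRoot_eq h0 h1]
  rw [signMat_eq h0 h1]
  apply eq_signOf_of_block (isRoot_locCoord h0 h1) (by exact_mod_cast h0.ne')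
    (ofReal_sq_sub_one_ne_zero h0 h1) (ofReal_sq_add_one_ne_zero h0)
  · rw [← hr, ← D.toBlock_x h0 h1]
    exact (commute_root _).map D.toBlock
  · rw [← hr, ← map_mul, root_mul_root h0 h1, ← rootSq_map]
    congr 1
    funext α
    exact D.toBlock_x h0 h1 α

theorem Calculus.eq (D D' : Calculus q) (h0 : 0 < q) (h1 : q ≠ 1) : D = D' := by
  have h : ∀ f, D.toBlock f = D'.toBlock f := by
    refine MinkSqrt.mem_of_generators h0 h1 (AlgHom.equalizer D.toBlock D'.toBlock) (fun α => ?_) ?_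
    · rw [AlgHom.mem_equalizer, D.toBlock_x h0 h1, D'.toBlock_x h0 h1]
    · rw [AlgHom.mem_equalizer, D.toBlock_apply, D'.toBlock_apply, D.twist_root, D'.twist_root,
        D.grad_root h0 h1, D'.grad_root h0 h1]
  ext1
  · ext1 f
    exact (block_inj.1 (h f)).1
  · ext1 f
    exact (block_inj.1 (h f)).2.1

theorem exists_calculus (h0 : 0 < q) (h1 : q ≠ 1) : Nonempty (Calculus q) := by
  have hq : (q : ℂ) ≠ 0 := by exact_mod_cast h0.ne'
  have hq1 := ofReal_sq_sub_one_ne_zero h0 h1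
  have hq2 := ofReal_sq_add_one_ne_zero h0
  have hR := isRoot_locCoord h0 h1
  obtain ⟨Φ, hx, hr⟩ := exists_algHom h0 h1 (isMinkFamily_coordBlock hR.family hq hq2)
    (commute_rootBlock hR hq hq1 hq2) (rootBlock_mul_rootBlock hR hq hq1 hq2)
  -- Block triangularity is inherited from the generators.
  have hΦ : ∀ f, ∃ T v, Φ f = block T v (toLoc q f) := by
    refine MinkSqrt.mem_of_generators h0 h1
      { carrier := {f | ∃ T v, Φ f = block T v (toLoc q f)}
        mul_mem' := ?_
        add_mem' := ?_
        algebraMap_mem' := ?_ } (fun α => ⟨_, _, hx α⟩) ⟨_, _, hr⟩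
    · rintro f g ⟨T, v, h⟩ ⟨T', v', h'⟩
      exact ⟨_, _, by rw [map_mul, h, h', block_mul, map_mul]⟩
    · rintro f g ⟨T, v, h⟩ ⟨T', v', h'⟩
      exact ⟨_, _, by rw [map_add, h, h', block_add, map_add]⟩
    · intro c
      exact ⟨c • 1, c • 0, by rw [AlgHom.commutes, AlgHom.commutes, Algebra.algebraMap_eq_smul_one,
        Algebra.algebraMap_eq_smul_one, ← block_smul, block_one]⟩
  choose T v hTv using hΦ
  have hmul : ∀ f g, T (f * g) = T f * T g ∧ v (f * g) = _ ∧ _ := fun f g => by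
    have := map_mul Φ f g
    rw [hTv, hTv, hTv, block_mul, block_inj] at this
    exact this
  have hadd : ∀ f g, T (f + g) = T f + T g ∧ v (f + g) = _ ∧ _ := fun f g => by
    have := map_add Φ f g
    rw [hTv, hTv, hTv, block_add, block_inj] at this
    exact this
  have hsmul : ∀ (c : ℂ) f, T (c • f) = c • T f ∧ v (c • f) = _ ∧ _ := fun c f => by
    have := map_smul Φ c f
    rw [hTv, hTv, block_smul, block_inj] at this
    exact this
  have hone : T 1 = 1 := by
    have := map_one Φ
    rw [hTv, ← block_one, block_inj] at this
    exact this.1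
  have hx' : ∀ α, T (x q α) = _ ∧ v (x q α) = _ ∧ _ := fun α => by
    have := hx α
    rw [hTv, coordBlock, block_inj] at this
    exact this
  have hr' := hr
  rw [hTv, rootBlock, block_inj] at hr'
  exact ⟨{
    twist := AlgHom.ofLinearMap ⟨⟨T, fun f g => (hadd f g).1⟩, fun c f => (hsmul c f).1⟩ hone
      fun f g => (hmul f g).1
    grad := ⟨⟨v, fun f g => (hadd f g).2.1⟩, fun c f => (hsmul c f).2.1⟩
    twist_coord := fun α => by rw [Lcoord_eq h0 h1]; exact (hx' α).1
    twist_root := by rw [twistRoot_eq h0 h1]; exact hr'.1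
    grad_coord := fun α => (hx' α).2.1
    grad_mul := fun f g μ => congrFun (hmul f g).2.1 μ }⟩

/-! ### Gradients of ordered polynomials -/

theorem qNum_succ (h0 : 0 < q) (h1 : q ≠ 1) (n : ℕ) :
    (qNum q (n + 1) : ℂ) = 1 + (q : ℂ) ^ 2 * qNum q n := by
  have h : (q : ℂ) ^ 2 - 1 ≠ 0 := ofReal_sq_sub_one_ne_zero h0 h1
  rw [qNum, qNum]
  push_cast
  field_simp
  ring

theorem Calculus.grad_mul_of_central (D : Calculus q) {f g : MinkSqrt q} (hg : ∀ a, Commute g a) :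
    D.grad (f * g) = toLoc q g • D.grad f + D.twist f *ᵥ D.grad g := by
  ext μ
  rw [D.grad_mul, ← (commute_toLoc hg _).eq]
  rfl

/-- If `∇ a` is an eigenvector of `M a` with eigenvalue `q² a`, the Leibniz rule gives powers of `a`
their Jackson derivatives. For `k = 0` both sides vanish, whatever `k - 1` means. -/
theorem Calculus.grad_pow (D : Calculus q) (h0 : 0 < q) (h1 : q ≠ 1) {a : MinkSqrt q}
    (ha : ∀ f, Commute a f)
    (h : D.twist a *ᵥ D.grad a = (q : ℂ) ^ 2 • (toLoc q a • D.grad a)) (k : ℕ) :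
    D.grad (a ^ k) = (qNum q k : ℂ) • (toLoc q (a ^ (k - 1)) • D.grad a) := by
  induction k with
  | zero =>
    have h1 : D.grad 1 = 0 := by
      have := D.grad_mul_of_central (f := 1) (g := 1) fun a => Commute.one_left a
      simpa using this
    simp [h1, qNum]
  | succ k ih =>
    rw [pow_succ', D.grad_mul_of_central fun f => (ha f).pow_left k, ih, qNum_succ h0 h1,
      Matrix.mulVec_smul, mulVec_smul_of_central (commute_toLoc fun f => (ha f).pow_left _), h,
      smul_comm _ ((q : ℂ) ^ 2), smul_smul, smul_smul, ← map_mul, ← pow_succ, Nat.add_sub_cancel,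
      add_smul, one_smul, mul_comm (qNum q k : ℂ)]
    rcases k with _ | k
    · simp [qNum]
    · rfl

theorem Calculus.grad_xiPlus (D : Calculus q) (h0 : 0 < q) (h1 : q ≠ 1) :
    D.grad (xiPlus q) = PiPlus q *ᵥ D.grad (x q .zero) := by
  rw [xiPlus, map_smul, map_add, D.grad_root h0 h1, PiPlus, Matrix.smul_mulVec,
    Matrix.add_mulVec, Matrix.one_mulVec, D.grad_coord, Matrix.mulVec_single_one]
  rfl

theorem Calculus.grad_xiMinus (D : Calculus q) (h0 : 0 < q) (h1 : q ≠ 1) :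
    D.grad (xiMinus q) = PiMinus q *ᵥ D.grad (x q .zero) := by
  rw [xiMinus, map_smul, map_sub, D.grad_root h0 h1, PiMinus, Matrix.smul_mulVec,
    Matrix.sub_mulVec, Matrix.one_mulVec, D.grad_coord, Matrix.mulVec_single_one]
  rfl

theorem signMat_mul_signMat (h0 : 0 < q) (h1 : q ≠ 1) : signMat q * signMat q = 1 := by
  rw [signMat_eq h0 h1]
  exact signOf_mul_signOf (isRoot_locCoord h0 h1) (by exact_mod_cast h0.ne')
    (ofReal_sq_sub_one_ne_zero h0 h1) (ofReal_sq_add_one_ne_zero h0)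

theorem signMat_mulVec_grad_xiPlus (D : Calculus q) (h0 : 0 < q) (h1 : q ≠ 1) :
    signMat q *ᵥ D.grad (xiPlus q) = D.grad (xiPlus q) := by
  rw [D.grad_xiPlus h0 h1, Matrix.mulVec_mulVec, PiPlus, mul_smul_comm, mul_add,
    signMat_mul_signMat h0 h1, mul_one, add_comm]

theorem signMat_mulVec_grad_xiMinus (D : Calculus q) (h0 : 0 < q) (h1 : q ≠ 1) :
    signMat q *ᵥ D.grad (xiMinus q) = -D.grad (xiMinus q) := by
  rw [D.grad_xiMinus h0 h1, Matrix.mulVec_mulVec, PiMinus, mul_smul_comm, mul_sub,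
    signMat_mul_signMat h0 h1, mul_one, ← Matrix.neg_mulVec, ← smul_neg, neg_sub]

theorem Calculus.twist_x_zero (D : Calculus q) (h0 : 0 < q) (h1 : q ≠ 1) :
    D.twist (x q .zero) = ((q : ℂ) / 2) • (((q : ℂ) + (q : ℂ)⁻¹) •
      Matrix.scalar Idx (toLoc q (x q .zero)) + ((q : ℂ) - (q : ℂ)⁻¹) •
        (Matrix.scalar Idx (toLoc q (root q)) * signMat q)) := by
  rw [D.twist_coord, Lcoord_eq h0 h1, vecL_zero (by exact_mod_cast h0.ne')
    (ofReal_sq_sub_one_ne_zero h0 h1), signMat_eq h0 h1, scalar_mul_signOf (isRoot_locCoord h0 h1)]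
  rw [locCoord]
  module

theorem Calculus.twist_root_eq (D : Calculus q) (h0 : 0 < q) (h1 : q ≠ 1) :
    D.twist (root q) = ((q : ℂ) / 2) • (((q : ℂ) + (q : ℂ)⁻¹) •
      Matrix.scalar Idx (toLoc q (root q)) + ((q : ℂ) - (q : ℂ)⁻¹) •
        (Matrix.scalar Idx (toLoc q (x q .zero)) * signMat q)) := by
  rw [D.twist_root, twistRoot_eq h0 h1, signMat_eq h0 h1]
  rfl

/-- `M ξ₊ = ξ₊ (q² Π₊ + Π₋)`, in terms of the sign matrix `Π₊ - Π₋`. -/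
theorem Calculus.twist_xiPlus (D : Calculus q) (h0 : 0 < q) (h1 : q ≠ 1) :
    D.twist (xiPlus q) = ((q : ℂ) / 2) • (((q : ℂ) + (q : ℂ)⁻¹) •
      Matrix.scalar Idx (toLoc q (xiPlus q)) + ((q : ℂ) - (q : ℂ)⁻¹) •
        (Matrix.scalar Idx (toLoc q (xiPlus q)) * signMat q)) := by
  have h : Matrix.scalar Idx (toLoc q (xiPlus q)) = (2⁻¹ : ℂ) •
      (Matrix.scalar Idx (toLoc q (x q .zero)) + Matrix.scalar Idx (toLoc q (root q))) := by
    rw [xiPlus, map_smul, map_add, scalar_smul, map_add]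
  rw [h, smul_mul_assoc, add_mul, xiPlus, map_smul, map_add, D.twist_x_zero h0 h1,
    D.twist_root_eq h0 h1]
  module

/-- `M ξ₋ = ξ₋ (Π₊ + q² Π₋)`, in terms of the sign matrix `Π₊ - Π₋`. -/
theorem Calculus.twist_xiMinus (D : Calculus q) (h0 : 0 < q) (h1 : q ≠ 1) :
    D.twist (xiMinus q) = ((q : ℂ) / 2) • (((q : ℂ) + (q : ℂ)⁻¹) •
      Matrix.scalar Idx (toLoc q (xiMinus q)) - ((q : ℂ) - (q : ℂ)⁻¹) •
        (Matrix.scalar Idx (toLoc q (xiMinus q)) * signMat q)) := by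
  have h : Matrix.scalar Idx (toLoc q (xiMinus q)) = (2⁻¹ : ℂ) •
      (Matrix.scalar Idx (toLoc q (x q .zero)) - Matrix.scalar Idx (toLoc q (root q))) := by
    rw [xiMinus, map_smul, map_sub, scalar_smul, map_sub]
  rw [h, smul_mul_assoc, sub_mul, xiMinus, map_smul, map_sub, D.twist_x_zero h0 h1,
    D.twist_root_eq h0 h1]
  module

theorem Calculus.twist_xiPlus_mulVec (D : Calculus q) (h0 : 0 < q) (h1 : q ≠ 1) :
    D.twist (xiPlus q) *ᵥ D.grad (xiPlus q) =
      (q : ℂ) ^ 2 • (toLoc q (xiPlus q) • D.grad (xiPlus q)) ∧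
    D.twist (xiPlus q) *ᵥ D.grad (xiMinus q) = toLoc q (xiPlus q) • D.grad (xiMinus q) := by
  have hq : (q : ℂ) ≠ 0 := by exact_mod_cast h0.ne'
  rw [D.twist_xiPlus h0 h1]
  simp only [Matrix.smul_mulVec, Matrix.add_mulVec, scalar_mulVec, scalar_mul_mulVec,
    signMat_mulVec_grad_xiPlus D h0 h1, signMat_mulVec_grad_xiMinus D h0 h1, smul_neg]
  generalize toLoc q (xiPlus q) • D.grad (xiPlus q) = a
  generalize toLoc q (xiPlus q) • D.grad (xiMinus q) = b
  constructor <;> match_scalars <;> field_simp <;> ring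

theorem Calculus.twist_xiMinus_mulVec (D : Calculus q) (h0 : 0 < q) (h1 : q ≠ 1) :
    D.twist (xiMinus q) *ᵥ D.grad (xiMinus q) =
      (q : ℂ) ^ 2 • (toLoc q (xiMinus q) • D.grad (xiMinus q)) := by
  have hq : (q : ℂ) ≠ 0 := by exact_mod_cast h0.ne'
  rw [D.twist_xiMinus h0 h1]
  simp only [Matrix.smul_mulVec, Matrix.sub_mulVec, scalar_mulVec, scalar_mul_mulVec,
    signMat_mulVec_grad_xiMinus D h0 h1, smul_neg]
  generalize toLoc q (xiMinus q) • D.grad (xiMinus q) = b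
  match_scalars
  field_simp
  ring

theorem Calculus.grad_monomial (D : Calculus q) (h0 : 0 < q) (h1 : q ≠ 1) (k l : ℕ) :
    D.grad (xiPlus q ^ k * xiMinus q ^ l) =
      (qNum q k : ℂ) • (toLoc q (xiPlus q ^ (k - 1) * xiMinus q ^ l) • D.grad (xiPlus q)) +
      (qNum q l : ℂ) • (toLoc q (xiPlus q ^ k * xiMinus q ^ (l - 1)) • D.grad (xiMinus q)) := by
  have hp : ∀ f, Commute (xiPlus q) f := fun f =>
    ((commute_x_zero h0 h1 f).add_left (commute_root f)).smul_left _
  have hm : ∀ f, Commute (xiMinus q) f := fun f =>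
    ((commute_x_zero h0 h1 f).sub_left (commute_root f)).smul_left _
  obtain ⟨e1, e2⟩ := D.twist_xiPlus_mulVec h0 h1
  rw [D.grad_mul_of_central fun f => (hm f).pow_left l, D.grad_pow h0 h1 hp e1,
    D.grad_pow h0 h1 hm (D.twist_xiMinus_mulVec h0 h1), Matrix.mulVec_smul,
    mulVec_smul_of_central (commute_toLoc fun f => (hm f).pow_left _), map_pow D.twist,
    pow_mulVec_of_eigen (commute_toLoc hp) e2, smul_comm (toLoc q _) (qNum q k : ℂ), smul_smul,
    smul_smul, ← map_mul, ← map_pow, ← map_mul, ((hm _).pow_left l).eq, ((hm _).pow_left _).eq]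

theorem Calculus.grad_eval (D : Calculus q) (h0 : 0 < q) (h1 : q ≠ 1) (f : OrdPoly) :
    D.grad (f.eval (xiPlus q) (xiMinus q)) =
      toLoc q ((f.jackson₁ q).eval (xiPlus q) (xiMinus q)) • D.grad (xiPlus q) +
      toLoc q ((f.jackson₂ q).eval (xiPlus q) (xiMinus q)) • D.grad (xiMinus q) := by
  have hadd : ∀ f g : OrdPoly, (f + g).eval (xiPlus q) (xiMinus q) =
      f.eval (xiPlus q) (xiMinus q) + g.eval (xiPlus q) (xiMinus q) := fun f g =>
    Finsupp.sum_add_index' (by simp) (by simp [add_smul])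
  have hsingle : ∀ (k : ℕ × ℕ) (z : ℂ), OrdPoly.eval (xiPlus q) (xiMinus q) (Finsupp.single k z) =
      z • (xiPlus q ^ k.1 * xiMinus q ^ k.2) := fun k z => Finsupp.sum_single_index (by simp)
  have hj₁ : ∀ f g : OrdPoly, (f + g).jackson₁ q = f.jackson₁ q + g.jackson₁ q := fun f g =>
    Finsupp.sum_add_index' (by simp) (by simp [add_mul])
  have hj₂ : ∀ f g : OrdPoly, (f + g).jackson₂ q = f.jackson₂ q + g.jackson₂ q := fun f g =>
    Finsupp.sum_add_index' (by simp) (by simp [add_mul])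
  induction f using Finsupp.induction_linear with
  | zero => simp [OrdPoly.eval, OrdPoly.jackson₁, OrdPoly.jackson₂]
  | add f g hf hg => 
    rw [hadd, hj₁, hj₂, hadd, hadd, map_add, map_add, map_add, hf, hg, add_smul, add_smul]
    abel
  | single k z =>
    have e₁ : OrdPoly.jackson₁ q (Finsupp.single k z) =
        Finsupp.single (k.1 - 1, k.2) (z * (qNum q k.1 : ℂ)) := Finsupp.sum_single_index (by simp)
    have e₂ : OrdPoly.jackson₂ q (Finsupp.single k z) =
        Finsupp.single (k.1, k.2 - 1) (z * (qNum q k.2 : ℂ)) := Finsupp.sum_single_index (by simp)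
    rw [e₁, e₂, hsingle, hsingle, hsingle, map_smul, D.grad_monomial h0 h1, map_smul, map_smul,
      smul_add, smul_smul, smul_smul, smul_assoc, smul_assoc]

end

end QMinkowski

theorem mainTheorem1 (q : ℝ) (hq0 : 0 < q) (hq1 : q ≠ 1) :
    (∃ D₀ : QMinkowski.Calculus q, ∀ D : QMinkowski.Calculus q, D = D₀) ∧
    ∀ D : QMinkowski.Calculus q,
      (D.grad (QMinkowski.xiPlus q) =
        (QMinkowski.PiPlus q).mulVec (D.grad (QMinkowski.x q .zero))) ∧
      (D.grad (QMinkowski.xiMinus q) =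
        (QMinkowski.PiMinus q).mulVec (D.grad (QMinkowski.x q .zero))) ∧
      ∀ f : QMinkowski.OrdPoly,
        D.grad (f.eval (QMinkowski.xiPlus q) (QMinkowski.xiMinus q)) =
          QMinkowski.toLoc q ((f.jackson₁ q).eval (QMinkowski.xiPlus q) (QMinkowski.xiMinus q)) •
              D.grad (QMinkowski.xiPlus q) +
            QMinkowski.toLoc q ((f.jackson₂ q).eval (QMinkowski.xiPlus q) (QMinkowski.xiMinus q)) •
              D.grad (QMinkowski.xiMinus q) := by
  obtain ⟨D₀⟩ := QMinkowski.exists_calculus hq0 hq1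
  exact ⟨⟨D₀, fun D => D.eq D₀ hq0 hq1⟩, fun D =>
    ⟨D.grad_xiPlus hq0 hq1, D.grad_xiMinus hq0 hq1, D.grad_eval hq0 hq1⟩⟩
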